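/- **Setting.** Let $\chi$ be a topological space with its Borel $\sigma$-algebra and a $\sigma$-finite measure $\nu$, and let $\mu$ be a $\sigma$-finite Borel measure on $\mathbb R^d$. Let $\Theta,\Theta_0\subset\mathbb R^d$ be compact, let $\widehat\Theta\supseteq\Theta\cup\Theta_0$ be closed and convex, let $\Theta_H\subset\widehat\Theta$ be finite, and let $\chi_c\subset\chi$ be compact. Let $p(x|\theta)\ge 0$ be a jointly measurable kernel such that $p(\cdot|\theta)$ is a probability density with respect to $\nu$ for each $\theta\in\widehat\Theta$. For a probability density $g$ with respect to $\mu$ write $m_g(x)=\int p(x|\theta)g(\theta)\,\mu(d\theta)$. Let $f$ be a density supported on $\Theta$, put $m=m_f$, and let $f_0$ be a density whose support is $\Theta_0$ (possibly different from $\Theta$). Let $\mathcal F_0$ be the class of all densities with respect to $\mu$ supported on $\Theta_0$, and let $\tilde k=\inf_{\hat f\in\mathcal F_0}KL(m,m_{\hat f})$, where $KL(m,m')=\int m\log(m/m')\,d\nu$. Let $q\ge 1$ and let $X_1,X_2,\dots$ be $\chi$-valued random variables, each with density $m$ with respect to $\nu$, forming a $(q-1)$-dependent sequence: for every $i\ge1$,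 $(X_1,\dots,X_i)$ is independent of $(X_{i+q},X_{i+q+1},\dots)$. Given weights $w_i\in(0,1]$, define for $i\ge 1$ $$f_i(\theta)=(1-w_i)f_{i-1}(\theta)+w_i\frac{p(X_i|\theta)f_{i-1}(\theta)}{m_{i-1}(X_i)},\qquad m_i=m_{f_i}\ (i\ge 0).$$ **Assumptions.** Ratios of kernel values are taken in $[0,\infty]$, with $a/0=\infty$ for $a>0$ and $0/0=0$. * (A1) $w_n$ is non-increasing with $w_n\to0$; $\sum_{i\ge1}w_{j+iq}=\infty$ for $j=1,\dots,q$; and $\sum_i w_i^2<\infty$. * (A2) If $g,g'$ are densities supported on $\Theta$ and $m_g=m_{g'}$ $\nu$-a.e., then $g=g'$ $\mu$-a.e. * (A3) For every $x\in\chi$ the map $\theta\mapsto p(x|\theta)$ is bounded and continuous on $\Theta\cup\Theta_0$. * (A4) There is $B>0$ with $\int\{p(x|\theta_1)/p(x|\theta_2)\}^k\,p(x|\theta_3)\,\nu(dx)<B$ for all integers $0\le k\le 4q$, all $\theta_1,\theta_2\in\Theta\cup\Theta_0\cup\Theta_H$ and all $\theta_3\in\Theta$. * (C1) There is $c_u>1$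 such that for every $x\notin\chi_c$ there are $\theta_1^x,\theta_2^x\in\Theta_H$ with $\sup_{\theta,\theta'\in\Theta\cup\Theta_0}p(x|\theta)/p(x|\theta')\le c_u\,p(x|\theta_2^x)/p(x|\theta_1^x)$. * (C2) There is $a>0$ with $p(x|\theta)>a$ for all $x\in\chi_c$, $\theta\in\Theta\cup\Theta_0$. * (C3) There is $b<\infty$ with $p(x|\theta)<b$ for all $x\in\chi_c$, $\theta\in\Theta\cup\Theta_0$. **Theorem.** Under A1–A4 and C1–C3, $\tilde k<\infty$ and, with probability one, $KL(m,m_n)<\infty$ for all $n\ge 0$ and $$KL(m,m_n)-\tilde k\longrightarrow 0\qquad(n\to\infty).$$ -/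

import Mathlib

open MeasureTheory ProbabilityTheory Filter Topology
open scoped NNReal ENNReal

/-- `g` is a probability density with respect to `μ` that is supported on `S`. -/
def IsDensityOn {E : Type*} [MeasurableSpace E] (μ : Measure E) (S : Set E) (g : E → ℝ) : Prop :=
  Measurable g ∧ (∀ θ, 0 ≤ g θ) ∧ (∀ᵐ θ ∂μ, θ ∉ S → g θ = 0) ∧ ∫⁻ θ, ENNReal.ofReal (g θ) ∂μ = 1

/-- The mixture (marginal) density `m_g(x) = ∫ p(x | θ) g(θ) μ(dθ)`; the kernel value `p(x | θ)` is
written `p x θ`. -/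
noncomputable def mixture {χ E : Type*} [MeasurableSpace E] (p : χ → E → ℝ≥0) (μ : Measure E)
    (g : E → ℝ) (x : χ) : ℝ :=
  ∫ θ, (p x θ : ℝ) * g θ ∂μ

/-- The measure with density `h` with respect to `ν`. -/
noncomputable def densityMeasure {χ : Type*} [MeasurableSpace χ] (ν : Measure χ) (h : χ → ℝ) :
    Measure χ :=
  ν.withDensity (fun x => ENNReal.ofReal (h x))

/-- The Kullback-Leibler divergence `KL(h, h') = ∫ h log (h / h') dν` of two densities with respect
to `ν`, with values in `[0, ∞]`. -/
noncomputable def klDensity {χ : Type*} [MeasurableSpace χ] (ν : Measure χ) (h h' : χ → ℝ) : ℝ≥0∞ :=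
  InformationTheory.klDiv (densityMeasure ν h) (densityMeasure ν h')

/-- The predictive recursion estimates `f_0, f_1, f_2, …` of the mixing density, computed with weights
`w 1, w 2, …` from the observations `x 1, x 2, …` (the values `w 0` and `x 0` are not used):
`f_i(θ) = (1 - w_i) f_{i-1}(θ) + w_i p(x_i | θ) f_{i-1}(θ) / m_{i-1}(x_i)`, where `m_{i-1}` is the
mixture density with mixing density `f_{i-1}`. -/
noncomputable def predictiveRecursion {χ E : Type*} [MeasurableSpace E] (p : χ → E → ℝ≥0)
    (μ : Measure E) (w : ℕ → ℝ) (f₀ : E → ℝ) (x : ℕ → χ) : ℕ → E → ℝ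
  | 0 => f₀
  | n + 1 => fun θ =>
      (1 - w (n + 1)) * predictiveRecursion p μ w f₀ x n θ
        + w (n + 1) * ((p (x (n + 1)) θ : ℝ) * predictiveRecursion p μ w f₀ x n θ
            / mixture p μ (predictiveRecursion p μ w f₀ x n) (x (n + 1)))

/-- The infimum of `KL(m, m_g)` over all mixtures `m_g` whose mixing density `g` is supported on
`Θ₀`. -/
noncomputable def infKL {χ E : Type*} [MeasurableSpace χ] [MeasurableSpace E] (p : χ → E → ℝ≥0)
    (ν : Measure χ) (μ : Measure E) (Θ₀ : Set E) (m : χ → ℝ) : ℝ≥0∞ :=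
  ⨅ (g : E → ℝ) (_ : IsDensityOn μ Θ₀ g), klDensity ν m (mixture p μ g)

/-- The sequence `X 1, X 2, …` is `M`-dependent: for every `i ≥ 1` the block `X 1, …, X i` is
independent of the block `X (i + M + 1), X (i + M + 2), …`. -/
def IsMDependent {Ω χ : Type*} [MeasurableSpace Ω] [mχ : MeasurableSpace χ] (M : ℕ)
    (X : ℕ → Ω → χ) (P : Measure Ω) : Prop :=
  ∀ i : ℕ, 1 ≤ i →
    Indep (⨆ j ∈ Set.Icc 1 i, mχ.comap (X j)) (⨆ j ∈ Set.Ici (i + M + 1), mχ.comap (X j)) P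

/-- Condition A1 on the weights `w 1, w 2, …`. -/
def CondA1 (q : ℕ) (w : ℕ → ℝ) : Prop :=
  AntitoneOn w (Set.Ici 1) ∧ Tendsto w atTop (𝓝 0) ∧
    (∀ j ∈ Set.Icc 1 q, ¬ Summable (fun i : ℕ => w (j + i * q))) ∧
    Summable (fun i : ℕ => w i ^ 2)

/-- Condition A2: a mixing density on `Θ` is identifiable from its mixture. -/
def CondA2 {χ E : Type*} [MeasurableSpace χ] [MeasurableSpace E] (p : χ → E → ℝ≥0)
    (ν : Measure χ) (μ : Measure E) (Θ : Set E) : Prop :=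
  ∀ g g' : E → ℝ, IsDensityOn μ Θ g → IsDensityOn μ Θ g' →
    mixture p μ g =ᵐ[ν] mixture p μ g' → g =ᵐ[μ] g'

/-- Condition A3: for every `x` the map `θ ↦ p(x | θ)` is bounded and continuous on `T`. -/
def CondA3 {χ E : Type*} [TopologicalSpace E] (p : χ → E → ℝ≥0) (T : Set E) : Prop :=
  ∀ x : χ, BddAbove (p x '' T) ∧ ContinuousOn (p x) T

/-- Condition A4: the moments of order `k ≤ 4q` of the ratios `p(x | θ₁) / p(x | θ₂)`,
`θ₁, θ₂ ∈ S`, under `p(x | θ₃)`, `θ₃ ∈ Θ`, are uniformly bounded. Ratios are taken in `[0, ∞]`, with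
`a / 0 = ∞` for `a > 0`. -/
def CondA4 {χ E : Type*} [MeasurableSpace χ] (p : χ → E → ℝ≥0) (ν : Measure χ) (q : ℕ)
    (S Θ : Set E) : Prop :=
  ∃ B : ℝ≥0, 0 < B ∧ ∀ k : ℕ, k ≤ 4 * q → ∀ θ₁ ∈ S, ∀ θ₂ ∈ S, ∀ θ₃ ∈ Θ,
    ∫⁻ x, ((p x θ₁ : ℝ≥0∞) / (p x θ₂ : ℝ≥0∞)) ^ k * (p x θ₃ : ℝ≥0∞) ∂ν < B

/-- Condition C1: off `χc`, the ratios of kernel values at parameters in `T` are dominated, up to a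
constant, by such a ratio at two points of `ΘH`. Ratios are taken in `[0, ∞]`. -/
def CondC1 {χ E : Type*} (p : χ → E → ℝ≥0) (T ΘH : Set E) (χc : Set χ) : Prop :=
  ∃ cu : ℝ≥0, 1 < cu ∧ ∀ x ∉ χc, ∃ θ₁ ∈ ΘH, ∃ θ₂ ∈ ΘH, ∀ θ ∈ T, ∀ θ' ∈ T,
    (p x θ : ℝ≥0∞) / (p x θ' : ℝ≥0∞) ≤ cu * ((p x θ₂ : ℝ≥0∞) / (p x θ₁ : ℝ≥0∞))

/-- Condition C2: the kernel is bounded away from zero on `χc × T`. -/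
def CondC2 {χ E : Type*} (p : χ → E → ℝ≥0) (T : Set E) (χc : Set χ) : Prop :=
  ∃ a : ℝ≥0, 0 < a ∧ ∀ x ∈ χc, ∀ θ ∈ T, a < p x θ

/-- Condition C3: the kernel is bounded on `χc × T`. -/
def CondC3 {χ E : Type*} (p : χ → E → ℝ≥0) (T : Set E) (χc : Set χ) : Prop :=
  ∃ b : ℝ≥0, ∀ x ∈ χc, ∀ θ ∈ T, p x θ < b

/-! Dividing the kernel by `m` and taking `F = f₀ dμ` as base measure changes nothing essential in
the recursion: the mixing densities relative to `F` start from the constant 1, and `KL(m, m_g)`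
becomes the loss `L(g) = -∫ log m_g dM`, where `M` is the law of an observation. The kernel
conditions provide one function `R ≥ 1`, square integrable under `M`, that bounds the normalised
kernel, its inverse and its ratios at `x` (`exists_ratioBound`, `RatioBound.ratioKernel`). Below,
`f_n` denotes the densities relative to `F`. Two functionals of `f_n` are followed.

The loss itself. A second order expansion gives `L(f_n) ≤ L(f_{n-1}) - w_n (s(X_n) - 1) + 2 w_n²
R(X_n)²`, where `s(y)` is the mean of `coMixture` under `M`. With `A(θ) = ∫ r(x|θ) / m_g(x) dM` one
has `∫ s dM = ∫ A² g dF ≥ (∫ A g dF)² = 1`. On average the loss therefore does not increase, and it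
converges.

The functional `∫ log f_n · b dF` for a bounded density `b`. It is bounded above, and its mean
increment is at least `w_n (∫ m_b / m_{n-1} dM - 1) ≥ w_n (L(f_{n-1}) - L(b))`, up to `w_n²` terms.
Since `∑ w_n = ∞`, the limiting loss cannot exceed `L(b)`.

Dependence is handled by delay. The score at `X_{k+q}` is evaluated at `f_k` instead of `f_{k+q-1}`;
`f_k` is a function of `X_1, …, X_k`, which are independent of `X_{k+q}`. The delay costs products
`w_i R(X_i) w_j R(X_j)` with `|i - j| < q`, which are summable because `∑ w_i² R(X_i)²` is finite
almost surely. The centred delayed scores form `q` interlaced martingale difference series, bounded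
in `L²` (`ae_exists_score_ge`).

A density on `Θ₀` need not have a density relative to `F`, let alone a bounded one. Spreading its
mass over small balls, which all have positive `F`-mass, produces bounded `b` whose losses approach
its divergence (`RatioBound.exists_logLoss_lt`). So the limiting loss is at most the infimum; it is
at least the infimum because every `m_n` is itself a mixture over `Θ₀`. -/

/-! ### Almost sure convergence of centred series -/

theorem integral_sq_sum_eq_of_condExp_eq_zero {Ω : Type*} [mΩ : MeasurableSpace Ω] {P : Measure Ω}
    [IsProbabilityMeasure P] (G : Filtration ℕ mΩ) (Y : ℕ → Ω → ℝ)
    (hmeas : ∀ n, StronglyMeasurable[G (n + 1)] (Y n)) (hL : ∀ n, MemLp (Y n) 2 P)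
    (hc : ∀ n, P[Y n | G n] =ᵐ[P] 0) (n : ℕ) :
    ∫ ω, (∑ i ∈ Finset.range n, Y i ω) ^ 2 ∂P = ∑ i ∈ Finset.range n, ∫ ω, Y i ω ^ 2 ∂P := by
  induction n with
  | zero => simp
  | succ n ih =>
    have hS : MemLp (fun ω => ∑ i ∈ Finset.range n, Y i ω) 2 P :=
      memLp_finsetSum _ fun i _ => hL i
    have hSm : StronglyMeasurable[G n] (fun ω => ∑ i ∈ Finset.range n, Y i ω) :=
      Finset.stronglyMeasurable_fun_sum _ fun i hi =>
        (hmeas i).mono (G.mono (Finset.mem_range.1 hi))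
    have hSY : Integrable ((fun ω => ∑ i ∈ Finset.range n, Y i ω) * Y n) P :=
      hS.integrable_mul (hL n)
    have hcross : ∫ ω, (∑ i ∈ Finset.range n, Y i ω) * Y n ω ∂P = 0 := by
      have h1 := condExp_mul_of_stronglyMeasurable_left hSm hSY ((hL n).integrable one_le_two)
      have h2 : P[(fun ω => ∑ i ∈ Finset.range n, Y i ω) * Y n | G n] =ᵐ[P] 0 := by
        filter_upwards [h1, hc n] with ω h1 h2
        simp [h1, h2]
      calc _ = ∫ ω, (P[(fun ω => ∑ i ∈ Finset.range n, Y i ω) * Y n | G n]) ω ∂P :=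
            (integral_condExp (G.le n)).symm
        _ = 0 := by rw [integral_congr_ae h2]; simp
    have hexp : ∀ ω, (∑ i ∈ Finset.range (n + 1), Y i ω) ^ 2
        = (∑ i ∈ Finset.range n, Y i ω) ^ 2
          + 2 * ((∑ i ∈ Finset.range n, Y i ω) * Y n ω) + Y n ω ^ 2 := by
      intro ω
      rw [Finset.sum_range_succ]
      ring
    simp_rw [hexp]
    have hSY' : Integrable (fun ω => 2 * ((∑ i ∈ Finset.range n, Y i ω) * Y n ω)) P :=
      hSY.const_mul 2
    have hadd : Integrable (fun ω => (∑ i ∈ Finset.range n, Y i ω) ^ 2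
        + 2 * ((∑ i ∈ Finset.range n, Y i ω) * Y n ω)) P := hS.integrable_sq.add hSY'
    rw [integral_add hadd (hL n).integrable_sq,
      integral_add hS.integrable_sq hSY', integral_const_mul, hcross, ih,
      Finset.sum_range_succ]
    ring

/-- The partial sums are a martingale. Orthogonality of the increments bounds it in `L²`, hence in
`L¹` through `|s| ≤ s² + 1`, and Doob's convergence theorem applies. -/
theorem ae_tendsto_sum_of_condExp_eq_zero {Ω : Type*} [mΩ : MeasurableSpace Ω] {P : Measure Ω}
    [IsProbabilityMeasure P] (G : Filtration ℕ mΩ) (Y : ℕ → Ω → ℝ)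
    (hmeas : ∀ n, StronglyMeasurable[G (n + 1)] (Y n)) (hL : ∀ n, MemLp (Y n) 2 P)
    (hc : ∀ n, P[Y n | G n] =ᵐ[P] 0) (hsum : Summable fun n => ∫ ω, Y n ω ^ 2 ∂P) :
    ∀ᵐ ω ∂P, ∃ l, Tendsto (fun n => ∑ i ∈ Finset.range n, Y i ω) atTop (𝓝 l) := by
  have hS (n : ℕ) : MemLp (fun ω => ∑ i ∈ Finset.range n, Y i ω) 2 P :=
    memLp_finsetSum _ fun i _ => hL i
  have hmart : Martingale (fun n ω => ∑ i ∈ Finset.range n, Y i ω) G P := by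
    refine martingale_of_condExp_sub_eq_zero_nat (fun n => ?_)
      (fun n => (hS n).integrable one_le_two) (fun n => ?_)
    · exact Finset.stronglyMeasurable_fun_sum _ fun i hi =>
        (hmeas i).mono (G.mono (Finset.mem_range.1 hi))
    · have : ((fun ω => ∑ i ∈ Finset.range (n + 1), Y i ω)
          - fun ω => ∑ i ∈ Finset.range n, Y i ω) = Y n := by
        ext ω
        simp [Finset.sum_range_succ]
      rw [this]
      exact hc n
  refine hmart.submartingale.exists_ae_tendsto_of_bdd
    (R := Real.toNNReal ((∑' n, ∫ ω, Y n ω ^ 2 ∂P) + 1)) (fun n => ?_)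
  rw [eLpNorm_one_eq_lintegral_enorm, ← ofReal_integral_norm_eq_lintegral_enorm
    ((hS n).integrable one_le_two)]
  refine ENNReal.ofReal_le_ofReal ?_
  calc ∫ ω, ‖∑ i ∈ Finset.range n, Y i ω‖ ∂P
      ≤ ∫ ω, ((∑ i ∈ Finset.range n, Y i ω) ^ 2 + 1) ∂P := by
        refine integral_mono ((hS n).integrable one_le_two).norm
          ((hS n).integrable_sq.add (integrable_const 1)) fun ω => ?_
        simp only [Real.norm_eq_abs]
        rw [← sq_abs]
        nlinarith [sq_nonneg (|∑ i ∈ Finset.range n, Y i ω| - 1),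
          abs_nonneg (∑ i ∈ Finset.range n, Y i ω)]
    _ = ∑ i ∈ Finset.range n, ∫ ω, Y i ω ^ 2 ∂P + 1 := by
        rw [integral_add (hS n).integrable_sq (integrable_const 1),
          integral_sq_sum_eq_of_condExp_eq_zero G Y hmeas hL hc]
        simp
    _ ≤ _ := by
        gcongr
        exact hsum.sum_le_tsum _ fun i _ => integral_nonneg fun ω => sq_nonneg _

/-- A series of random variables, each centred given the `σ`-algebra `q` steps earlier, with
summable second moments converges almost surely. -/
theorem ae_tendsto_sum_of_condExp_lag_eq_zero {Ω : Type*} [mΩ : MeasurableSpace Ω] {P : Measure Ω}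
    [IsProbabilityMeasure P] (F : Filtration ℕ mΩ) (Y : ℕ → Ω → ℝ) {q : ℕ} (hq : 1 ≤ q)
    (hmeas : ∀ n, StronglyMeasurable[F (n + q)] (Y n)) (hL : ∀ n, MemLp (Y n) 2 P)
    (hc : ∀ n, P[Y n | F n] =ᵐ[P] 0) (hsum : Summable fun n => ∫ ω, Y n ω ^ 2 ∂P) :
    ∀ᵐ ω ∂P, ∃ l, Tendsto (fun n => ∑ i ∈ Finset.range n, Y i ω) atTop (𝓝 l) := by
  -- The series is split by residue classes modulo `q`; within one class the terms are genuine
  -- martingale differences.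
  have key : ∀ j ∈ Finset.range q, ∀ᵐ ω ∂P, ∃ l, Tendsto
      (fun n => ∑ i ∈ Finset.range n, if i % q = j then Y i ω else 0) atTop (𝓝 l) := by
    intro j hj
    let G : Filtration ℕ mΩ :=
      { seq := fun N => ⨆ n ∈ {n | n < N ∧ n % q = j}, F (n + q)
        mono' := fun N N' h => biSup_mono fun n hn => ⟨hn.1.trans_le h, hn.2⟩
        le' := fun N => iSup₂_le fun n _ => F.le (n + q) }
    have hite : ∀ n, (fun ω => if n % q = j then Y n ω else 0)
        = if n % q = j then Y n else 0 := by
      intro n; ext ω; split_ifs <;> rfl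
    refine ae_tendsto_sum_of_condExp_eq_zero G (fun n ω => if n % q = j then Y n ω else 0)
      (fun n => ?_) (fun n => ?_) (fun n => ?_) ?_
    · rw [hite]
      split_ifs with h
      · exact (hmeas n).mono (le_iSup₂_of_le (f := fun n (_ : n ∈ {k | k < _ ∧ k % q = j}) => F (n + q))
          n ⟨Nat.lt_succ_self n, h⟩ le_rfl)
      · exact stronglyMeasurable_zero
    · rw [hite]
      split_ifs with h
      · exact hL n
      · exact MemLp.zero
    · rw [hite]
      split_ifs with h
      -- Two indices of one class differ by at least `q`, so everything revealed by the earlier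
      -- terms of the class already lies in `F n`.
      · have hle : G n ≤ F n := by
          refine iSup₂_le fun k hk => F.mono ?_
          have hmod : k ≡ n [MOD q] := hk.2.trans h.symm
          have h1 := (Nat.modEq_iff_dvd' hk.1.le).1 hmod
          have h2 := Nat.le_of_dvd (Nat.sub_pos_of_lt hk.1) h1
          have := hk.1
          omega
        have h1 := condExp_condExp_of_le (f := Y n) (μ := P) hle (F.le _)
        refine h1.symm.trans ((condExp_congr_ae (hc n)).trans ?_)
        rw [condExp_zero]
      · rw [condExp_zero]
    · refine hsum.of_nonneg_of_le (fun n => integral_nonneg fun ω => sq_nonneg _) fun n => ?_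
      split_ifs with h
      · exact le_rfl
      · simpa using integral_nonneg fun ω => sq_nonneg (Y n ω)
  filter_upwards [(ae_ball_iff (Finset.range q).countable_toSet).2 key] with ω hω
  choose! l hl using hω
  refine ⟨∑ j ∈ Finset.range q, l j, (tendsto_finsetSum _ fun j hj => hl j hj).congr fun n => ?_⟩
  rw [Finset.sum_comm]
  refine Finset.sum_congr rfl fun i _ => ?_
  rw [Finset.sum_ite_eq, if_pos (Finset.mem_range.2 (Nat.mod_lt _ hq))]

/-! ### Kernels with bounded ratios and one step of the recursion -/

/-- A positive kernel whose values at a point `x`, and their ratios, lie between `(R x)⁻¹`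
and `R x`. -/
structure RatioKernel {χ E : Type*} [MeasurableSpace χ] [MeasurableSpace E] (r : χ → E → ℝ≥0)
    (R : χ → ℝ) : Prop where
  meas : Measurable (Function.uncurry r)
  meas_bound : Measurable R
  one_le : ∀ x, 1 ≤ R x
  ratio : ∀ x θ θ', (r x θ : ℝ) ≤ R x * r x θ'
  le : ∀ x θ, (r x θ : ℝ) ≤ R x
  ge : ∀ x θ, 1 ≤ R x * r x θ

/-- One step of predictive recursion from the mixing density `g`, with weight `v` and
observation `y`. -/
noncomputable def recursionStep {χ E : Type*} [MeasurableSpace E] (p : χ → E → ℝ≥0)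
    (μ : Measure E) (v : ℝ) (y : χ) (g : E → ℝ) : E → ℝ :=
  fun θ => (1 - v) * g θ + v * ((p y θ : ℝ) * g θ / mixture p μ g y)

section Density

variable {E : Type*} [MeasurableSpace E] {μ : Measure E} {S : Set E} {g : E → ℝ}

theorem IsDensityOn.integrable (hg : IsDensityOn μ S g) : Integrable g μ := by
  refine ⟨hg.1.aestronglyMeasurable, ?_⟩
  rw [hasFiniteIntegral_iff_ofReal (ae_of_all _ hg.2.1), hg.2.2.2]
  exact ENNReal.one_lt_top

theorem IsDensityOn.integral_eq_one (hg : IsDensityOn μ S g) : ∫ θ, g θ ∂μ = 1 := by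
  rw [integral_eq_lintegral_of_nonneg_ae (ae_of_all _ hg.2.1) hg.1.aestronglyMeasurable,
    hg.2.2.2, ENNReal.toReal_one]

theorem isDensityOn_univ_of_integral_eq_one (hm : Measurable g) (h0 : ∀ θ, 0 ≤ g θ)
    (hi : Integrable g μ) (h1 : ∫ θ, g θ ∂μ = 1) : IsDensityOn μ Set.univ g := by
  refine ⟨hm, h0, ae_of_all _ fun θ h => (h trivial).elim, ?_⟩
  rw [← ofReal_integral_eq_lintegral_ofReal hi (ae_of_all _ h0), h1, ENNReal.ofReal_one]

/-- The mean of a function that is at most `c` on `S` is at most `c`. -/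
theorem IsDensityOn.integral_mul_le (hg : IsDensityOn μ S g) {k : E → ℝ} {c : ℝ}
    (hk : Integrable (fun θ => k θ * g θ) μ) (hc : ∀ θ ∈ S, k θ ≤ c) :
    ∫ θ, k θ * g θ ∂μ ≤ c := by
  calc ∫ θ, k θ * g θ ∂μ ≤ ∫ θ, c * g θ ∂μ :=
        integral_mono_ae hk (hg.integrable.const_mul c) (hg.2.2.1.mono fun θ hθ => by
          by_cases hS : θ ∈ S
          · exact mul_le_mul_of_nonneg_right (hc θ hS) (hg.2.1 θ)
          · simp [hθ hS])
    _ = c := by rw [integral_const_mul, hg.integral_eq_one, mul_one]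

theorem IsDensityOn.le_integral_mul (hg : IsDensityOn μ S g) {k : E → ℝ} {c : ℝ}
    (hk : Integrable (fun θ => k θ * g θ) μ) (hc : ∀ θ ∈ S, c ≤ k θ) :
    c ≤ ∫ θ, k θ * g θ ∂μ := by
  calc c = ∫ θ, c * g θ ∂μ := by rw [integral_const_mul, hg.integral_eq_one, mul_one]
    _ ≤ _ := integral_mono_ae (hg.integrable.const_mul c) hk (hg.2.2.1.mono fun θ hθ => by
          by_cases hS : θ ∈ S
          · exact mul_le_mul_of_nonneg_right (hc θ hS) (hg.2.1 θ)
          · simp [hθ hS])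

end Density

theorem measurable_mixture {χ E : Type*} [MeasurableSpace χ] [MeasurableSpace E]
    {p : χ → E → ℝ≥0} {μ : Measure E} {g : E → ℝ} [SFinite μ] (hp : Measurable (Function.uncurry p)) (hg : Measurable g) :
    Measurable (mixture p μ g) :=
  ((hp.coe_nnreal_real.mul (hg.comp measurable_snd)).stronglyMeasurable.integral_prod_right'
    (ν := μ)).measurable

namespace RatioKernel

variable {χ E : Type*} [MeasurableSpace χ] [MeasurableSpace E] {r : χ → E → ℝ≥0} {R : χ → ℝ}
  {F : Measure E} {g g' : E → ℝ}

theorem bound_pos (h : RatioKernel r R) (x : χ) : 0 < R x := one_pos.trans_le (h.one_le x)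

theorem measurable_apply (h : RatioKernel r R) (x : χ) : Measurable fun θ => (r x θ : ℝ) :=
  (h.meas.comp measurable_prodMk_left).coe_nnreal_real

theorem pos (h : RatioKernel r R) (x : χ) (θ : E) : 0 < (r x θ : ℝ) := by
  have := h.ge x θ
  have h1 := h.bound_pos x
  by_contra hn
  nlinarith [mul_nonpos_of_nonneg_of_nonpos h1.le (not_lt.1 hn)]

theorem integrable_mul (h : RatioKernel r R) {k : E → ℝ} (hk : Integrable k F) (x : χ) :
    Integrable (fun θ => (r x θ : ℝ) * k θ) F :=
  hk.bdd_mul (c := R x) (h.measurable_apply x).aestronglyMeasurable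
    (ae_of_all _ fun θ => by simpa using h.le x θ)

theorem mixture_le (h : RatioKernel r R) (hg : IsDensityOn F Set.univ g) (x : χ) :
    mixture r F g x ≤ R x :=
  hg.integral_mul_le (h.integrable_mul hg.integrable x) fun θ _ => h.le x θ

theorem one_le_mul_mixture (h : RatioKernel r R) (hg : IsDensityOn F Set.univ g) (x : χ) :
    1 ≤ R x * mixture r F g x := by
  have h1 : (R x)⁻¹ ≤ mixture r F g x :=
    hg.le_integral_mul (h.integrable_mul hg.integrable x) fun θ _ => by
      rw [inv_le_iff_one_le_mul₀' (h.bound_pos x)]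
      exact h.ge x θ
  rwa [inv_le_iff_one_le_mul₀' (h.bound_pos x)] at h1

theorem mixture_pos (h : RatioKernel r R) (hg : IsDensityOn F Set.univ g) (x : χ) :
    0 < mixture r F g x := by
  have := h.one_le_mul_mixture hg x
  have h1 := h.bound_pos x
  by_contra hn
  nlinarith [mul_nonpos_of_nonneg_of_nonpos h1.le (not_lt.1 hn)]

theorem le_mul_mixture (h : RatioKernel r R) (hg : IsDensityOn F Set.univ g) (x : χ) (θ : E) :
    (r x θ : ℝ) ≤ R x * mixture r F g x := by
  rw [mixture, ← integral_const_mul]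
  simp_rw [← mul_assoc]
  refine hg.le_integral_mul ?_ fun θ' _ => h.ratio x θ θ'
  simpa only [mul_assoc] using (h.integrable_mul hg.integrable x).const_mul (R x)

theorem mixture_le_mul (h : RatioKernel r R) (hg : IsDensityOn F Set.univ g) (x : χ) (θ : E) :
    mixture r F g x ≤ R x * r x θ :=
  hg.integral_mul_le (h.integrable_mul hg.integrable x) fun θ' _ => h.ratio x θ' θ

theorem div_mixture_le (h : RatioKernel r R) (hg : IsDensityOn F Set.univ g) (x : χ) (θ : E) :
    (r x θ : ℝ) / mixture r F g x ≤ R x :=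
  (div_le_iff₀ (h.mixture_pos hg x)).2 (h.le_mul_mixture hg x θ)

theorem mixture_div_le (h : RatioKernel r R) (hg : IsDensityOn F Set.univ g)
    (hg' : IsDensityOn F Set.univ g') (x : χ) :
    mixture r F g x / mixture r F g' x ≤ R x := by
  rw [div_le_iff₀ (h.mixture_pos hg' x)]
  exact hg.integral_mul_le (h.integrable_mul hg.integrable x) fun θ _ => h.le_mul_mixture hg' x θ

theorem measurable_mixture (h : RatioKernel r R) [SFinite F] (hg : Measurable g) :
    Measurable (mixture r F g) :=
  _root_.measurable_mixture h.meas hg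

/-- `log R ≤ R - 1`. The crude bound `R` is enough, since `R` is integrable wherever logarithms are
integrated. -/
theorem abs_log_le (h : RatioKernel r R) {x : χ} {t : ℝ} (h1 : t ≤ R x) (h2 : 1 ≤ R x * t) :
    |Real.log t| ≤ R x := by
  have hR := h.bound_pos x
  have ht : 0 < t := by
    by_contra hn
    nlinarith [mul_nonpos_of_nonneg_of_nonpos hR.le (not_lt.1 hn)]
  have h3 := Real.log_le_log ht h1
  have h4 := Real.log_le_sub_one_of_pos hR
  have h5 := Real.log_nonneg h2
  rw [Real.log_mul hR.ne' ht.ne'] at h5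
  rw [abs_le]
  constructor <;> linarith

theorem abs_log_mixture_le (h : RatioKernel r R) (hg : IsDensityOn F Set.univ g) (x : χ) :
    |Real.log (mixture r F g x)| ≤ R x :=
  h.abs_log_le (h.mixture_le hg x) (h.one_le_mul_mixture hg x)

section Step

variable {v : ℝ} {y : χ}

/-- The multiplicative form makes logarithms of successive densities telescope. -/
theorem recursionStep_eq (h : RatioKernel r R) (hg : IsDensityOn F Set.univ g) (θ : E) :
    recursionStep r F v y g θ = g θ * (1 + v * (r y θ / mixture r F g y - 1)) := by
  have := (h.mixture_pos hg y).ne'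
  rw [recursionStep]
  field_simp
  ring

theorem isDensityOn_recursionStep (h : RatioKernel r R) (hg : IsDensityOn F Set.univ g)
    (hv : 0 < v ∧ v ≤ 1) : IsDensityOn F Set.univ (recursionStep r F v y g) := by
  have hpos := h.mixture_pos hg y
  have hi := (h.integrable_mul hg.integrable y).div_const (mixture r F g y)
  refine isDensityOn_univ_of_integral_eq_one ?_ (fun θ => ?_) ?_ ?_
  · exact (hg.1.const_mul _).add
      ((((h.measurable_apply y).mul hg.1).div_const _).const_mul _)
  · have := hg.2.1 θ
    have := hv.1
    have := sub_nonneg.2 hv.2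
    unfold recursionStep
    positivity
  · exact (hg.integrable.const_mul _).add (hi.const_mul _)
  · unfold recursionStep
    rw [integral_add (hg.integrable.const_mul _) (hi.const_mul _), integral_const_mul,
      integral_const_mul, integral_div, hg.integral_eq_one,
      show ∫ θ, (r y θ : ℝ) * g θ ∂F = mixture r F g y from rfl, div_self hpos.ne']
    ring

theorem neg_one_le_sub_one (h : RatioKernel r R) (hg : IsDensityOn F Set.univ g) (θ : E) :
    -1 ≤ (r y θ : ℝ) / mixture r F g y - 1 := by
  have := div_nonneg (h.pos y θ).le (h.mixture_pos hg y).le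
  linarith

theorem recursionStep_le (h : RatioKernel r R) (hg : IsDensityOn F Set.univ g)
    (hv : 0 < v ∧ v ≤ 1) (θ : E) :
    recursionStep r F v y g θ ≤ (1 + v * R y) * g θ := by
  rw [h.recursionStep_eq hg, mul_comm]
  refine mul_le_mul_of_nonneg_right ?_ (hg.2.1 θ)
  have := h.div_mixture_le hg y θ
  nlinarith [mul_le_mul_of_nonneg_left this hv.1.le]

theorem le_recursionStep (h : RatioKernel r R) (hg : IsDensityOn F Set.univ g)
    (hv : 0 < v ∧ v ≤ 1) (θ : E) :
    (1 - v * R y) * g θ ≤ recursionStep r F v y g θ := by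
  rw [h.recursionStep_eq hg, mul_comm]
  refine mul_le_mul_of_nonneg_left ?_ (hg.2.1 θ)
  have := h.neg_one_le_sub_one hg (y := y) θ
  have := h.one_le y
  nlinarith [mul_le_mul_of_nonneg_left this hv.1.le, hv.1]

theorem integral_mul_recursionStep_le (h : RatioKernel r R) (hg : IsDensityOn F Set.univ g)
    (hv : 0 < v ∧ v ≤ 1) {k : E → ℝ} (hk : ∀ θ, 0 ≤ k θ)
    (hi : ∀ {g}, IsDensityOn F Set.univ g → Integrable (fun θ => k θ * g θ) F) :
    ∫ θ, k θ * recursionStep r F v y g θ ∂F ≤ (1 + v * R y) * ∫ θ, k θ * g θ ∂F := by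
  rw [← integral_const_mul]
  refine integral_mono (hi (h.isDensityOn_recursionStep hg hv)) ((hi hg).const_mul _) fun θ => ?_
  have := mul_le_mul_of_nonneg_left (h.recursionStep_le hg hv (y := y) θ) (hk θ)
  simp only
  linarith

theorem le_integral_mul_recursionStep (h : RatioKernel r R) (hg : IsDensityOn F Set.univ g)
    (hv : 0 < v ∧ v ≤ 1) {k : E → ℝ} (hk : ∀ θ, 0 ≤ k θ)
    (hi : ∀ {g}, IsDensityOn F Set.univ g → Integrable (fun θ => k θ * g θ) F) :
    (1 - v * R y) * ∫ θ, k θ * g θ ∂F ≤ ∫ θ, k θ * recursionStep r F v y g θ ∂F := by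
  rw [← integral_const_mul]
  refine integral_mono ((hi hg).const_mul _) (hi (h.isDensityOn_recursionStep hg hv)) fun θ => ?_
  have := mul_le_mul_of_nonneg_left (h.le_recursionStep hg hv (y := y) θ) (hk θ)
  simp only
  linarith

theorem mixture_recursionStep_le (h : RatioKernel r R) (hg : IsDensityOn F Set.univ g)
    (hv : 0 < v ∧ v ≤ 1) (x : χ) :
    mixture r F (recursionStep r F v y g) x ≤ (1 + v * R y) * mixture r F g x :=
  h.integral_mul_recursionStep_le hg hv (fun θ => (r x θ).2)
    fun hg => h.integrable_mul hg.integrable x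

end Step

/-- The average of `r(x | θ) r(y | θ)` with respect to `g`, normalised by the mixtures. -/
noncomputable def _root_.coMixture (r : χ → E → ℝ≥0) (F : Measure E) (g : E → ℝ) (y x : χ) : ℝ :=
  (∫ θ, (r x θ * r y θ : ℝ) * g θ ∂F) / (mixture r F g x * mixture r F g y)

theorem integrable_mul_mul (h : RatioKernel r R) {k : E → ℝ} (hk : Integrable k F) (y x : χ) :
    Integrable (fun θ => (r x θ * r y θ : ℝ) * k θ) F := by
  simpa only [mul_assoc] using h.integrable_mul (h.integrable_mul hk y) x

theorem coMixture_nonneg (h : RatioKernel r R) (hg : IsDensityOn F Set.univ g) (y x : χ) :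
    0 ≤ coMixture r F g y x :=
  div_nonneg (integral_nonneg fun θ => mul_nonneg (by positivity) (hg.2.1 θ))
    (mul_nonneg (h.mixture_pos hg x).le (h.mixture_pos hg y).le)

/-- Only `r(y|θ)` is estimated, by `R y` times its mixture; the factor `r(x|θ)` integrates exactly.
The bound is thus free of `x` and survives integration over `x`. -/
theorem coMixture_le (h : RatioKernel r R) (hg : IsDensityOn F Set.univ g) (y x : χ) :
    coMixture r F g y x ≤ R y := by
  rw [coMixture, div_le_iff₀ (mul_pos (h.mixture_pos hg x) (h.mixture_pos hg y))]
  calc ∫ θ, (r x θ * r y θ : ℝ) * g θ ∂F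
      ≤ ∫ θ, (R y * mixture r F g y) * ((r x θ : ℝ) * g θ) ∂F := by
        refine integral_mono (h.integrable_mul_mul hg.integrable y x)
          ((h.integrable_mul hg.integrable x).const_mul _) fun θ => ?_
        have := mul_le_mul_of_nonneg_right (h.le_mul_mixture hg y θ)
          (mul_nonneg (h.pos x θ).le (hg.2.1 θ))
        simp only
        linarith
    _ = _ := by
        rw [integral_const_mul, ← mixture]
        ring

theorem mixture_recursionStep (h : RatioKernel r R) (hg : IsDensityOn F Set.univ g)
    {v : ℝ} {y : χ} (x : χ) :
    mixture r F (recursionStep r F v y g) x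
      = mixture r F g x * (1 + v * (coMixture r F g y x - 1)) := by
  have hx := (h.mixture_pos hg x).ne'
  have hy := (h.mixture_pos hg y).ne'
  have : ∀ θ, (r x θ : ℝ) * recursionStep r F v y g θ
      = (1 - v) * (r x θ * g θ) + v / mixture r F g y * ((r x θ * r y θ : ℝ) * g θ) := by
    intro θ
    rw [recursionStep]
    field_simp
  rw [mixture]
  simp_rw [this]
  rw [integral_add ((h.integrable_mul hg.integrable x).const_mul _)
    ((h.integrable_mul_mul hg.integrable y x).const_mul _), integral_const_mul,
    integral_const_mul, ← mixture, coMixture]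
  field_simp
  ring

/-- With `ε = v R(y₀)`, a step shrinks the numerator by a factor at least `1 - ε` and enlarges each
of the two mixtures in the denominator by a factor at most `1 + ε`. The constant 3 comes from `(1 -
3ε)(1 + ε)² ≤ 1 - ε`. -/
theorem coMixture_recursionStep_ge (h : RatioKernel r R) (hg : IsDensityOn F Set.univ g)
    {v : ℝ} {y₀ : χ} (hv : 0 < v ∧ v ≤ 1) (y x : χ) :
    coMixture r F g y x - 3 * v * R y₀ * R y
      ≤ coMixture r F (recursionStep r F v y₀ g) y x := by
  have hg' := h.isDensityOn_recursionStep hg hv (y := y₀)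
  have hx := h.mixture_pos hg x
  have hy := h.mixture_pos hg y
  have hx' := h.mixture_pos hg' x
  have hy' := h.mixture_pos hg' y
  have h1 := h.mixture_recursionStep_le hg hv (y := y₀) x
  have h2 := h.mixture_recursionStep_le hg hv (y := y₀) y
  have h3 := h.le_integral_mul_recursionStep hg hv (y := y₀)
    (k := fun θ => (r x θ * r y θ : ℝ)) (fun θ => by positivity)
    fun hg => h.integrable_mul_mul hg.integrable y x
  have h4 := h.coMixture_nonneg hg y x
  have h5 := h.coMixture_le hg y x
  have h6 := h.coMixture_nonneg hg' y x
  set ε := v * R y₀ with hε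
  have hε0 : 0 ≤ ε := mul_nonneg hv.1.le (h.bound_pos y₀).le
  have hN : ∫ θ, (r x θ * r y θ : ℝ) * g θ ∂F
      = coMixture r F g y x * (mixture r F g x * mixture r F g y) := by
    rw [coMixture, div_mul_cancel₀ _ (mul_pos hx hy).ne']
  have hkey : (1 - 3 * ε) * coMixture r F g y x
      ≤ coMixture r F (recursionStep r F v y₀ g) y x := by
    rcases le_or_gt (1 - 3 * ε) 0 with hneg | hpos
    · exact (mul_nonpos_of_nonpos_of_nonneg hneg h4).trans h6
    · conv_rhs => rw [coMixture]
      rw [le_div_iff₀ (mul_pos hx' hy')]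
      refine le_trans ?_ h3
      rw [hN]
      calc (1 - 3 * ε) * coMixture r F g y x * (mixture r F (recursionStep r F v y₀ g) x
              * mixture r F (recursionStep r F v y₀ g) y)
          ≤ (1 - 3 * ε) * coMixture r F g y x
              * (((1 + ε) * mixture r F g x) * ((1 + ε) * mixture r F g y)) := by gcongr
        _ = ((1 - 3 * ε) * (1 + ε) ^ 2)
              * (coMixture r F g y x * (mixture r F g x * mixture r F g y)) := by ring
        _ ≤ _ := by
            refine mul_le_mul_of_nonneg_right ?_ (by positivity)
            nlinarith [pow_nonneg hε0 3, pow_nonneg hε0 2]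
  nlinarith [mul_le_mul_of_nonneg_left h5 hε0]

/-- Only one mixture in the denominator moves, so the factor `1 - ε` would do; the constant 3 gives
both scores the same form for `ae_exists_score_ge`. -/
theorem mixture_div_recursionStep_ge (h : RatioKernel r R) (hg : IsDensityOn F Set.univ g)
    (hg' : IsDensityOn F Set.univ g') {v : ℝ} {y₀ : χ} (hv : 0 < v ∧ v ≤ 1) (y : χ) :
    mixture r F g' y / mixture r F g y - 3 * v * R y₀ * R y
      ≤ mixture r F g' y / mixture r F (recursionStep r F v y₀ g) y := by
  have h1 := h.mixture_recursionStep_le hg hv (y := y₀) y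
  have hy := h.mixture_pos hg y
  have hy' := h.mixture_pos (h.isDensityOn_recursionStep hg hv (y := y₀)) y
  have hm := h.mixture_pos hg' y
  have h2 := h.mixture_div_le hg' hg y
  set ε := v * R y₀ with hε
  have hε0 : 0 ≤ ε := mul_nonneg hv.1.le (h.bound_pos y₀).le
  have h3 : (1 - ε) * (mixture r F g' y / mixture r F g y)
      ≤ mixture r F g' y / mixture r F (recursionStep r F v y₀ g) y := by
    rcases le_or_gt (1 - ε) 0 with hneg | hpos
    · exact (mul_nonpos_of_nonpos_of_nonneg hneg (by positivity)).trans (by positivity)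
    · rw [le_div_iff₀ hy']
      calc _ ≤ (1 - ε) * (mixture r F g' y / mixture r F g y) * ((1 + ε) * mixture r F g y) := by
            gcongr
        _ = (1 - ε ^ 2) * mixture r F g' y := by field_simp; ring
        _ ≤ _ := by nlinarith [sq_nonneg ε]
  have hR := (h.bound_pos y).le
  nlinarith [mul_le_mul_of_nonneg_left h2 hε0, mul_nonneg hε0 hR]

end RatioKernel

/-! ### Effect of one step on the two functionals -/

/-- From `log(1 + t) ≥ t / (1 + t)`: what remains is `t² (1 + 2t) ≥ 0`. This is the origin of the
restriction to weights at most `1/2` below. -/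
theorem sub_two_mul_sq_le_log {t : ℝ} (ht : -(1 / 2) ≤ t) : t - 2 * t ^ 2 ≤ Real.log (1 + t) := by
  have hpos : 0 < 1 + t := by linarith
  refine le_trans ?_ (Real.one_sub_inv_le_log_of_pos hpos)
  rw [show 1 - (1 + t)⁻¹ = t / (1 + t) by field_simp; ring, le_div_iff₀ hpos]
  nlinarith [sq_nonneg t, mul_nonneg (sq_nonneg t) (by linarith : 0 ≤ 1 + 2 * t)]

/-- The expected logarithmic loss `-∫ log m_g dM` of a mixture. -/
noncomputable def logLoss {χ E : Type*} [MeasurableSpace χ] [MeasurableSpace E] (r : χ → E → ℝ≥0)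
    (F : Measure E) (M : Measure χ) (g : E → ℝ) : ℝ :=
  -∫ x, Real.log (mixture r F g x) ∂M

namespace RatioKernel

variable {χ E : Type*} [MeasurableSpace χ] [MeasurableSpace E] {r : χ → E → ℝ≥0} {R : χ → ℝ}
  {F : Measure E} {g g' b : E → ℝ} {M : Measure χ} {v : ℝ} {y : χ}

theorem integrable_bound (h : RatioKernel r R) [IsProbabilityMeasure M]
    (hR : Integrable (fun x => R x ^ 2) M) : Integrable R M :=
  hR.mono' h.meas_bound.aestronglyMeasurable (ae_of_all _ fun x => by
    have := h.one_le x
    rw [Real.norm_of_nonneg (h.bound_pos x).le]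
    nlinarith)

theorem integrable_log_mixture (h : RatioKernel r R) [SFinite F] (hR : Integrable R M)
    (hg : IsDensityOn F Set.univ g) :
    Integrable (fun x => Real.log (mixture r F g x)) M :=
  hR.mono' (Real.measurable_log.comp (h.measurable_mixture hg.1)).aestronglyMeasurable
    (ae_of_all _ fun x => h.abs_log_mixture_le hg x)

theorem neg_integral_bound_le_logLoss (h : RatioKernel r R) [SFinite F] (hR : Integrable R M)
    (hg : IsDensityOn F Set.univ g) : -∫ x, R x ∂M ≤ logLoss r F M g :=
  neg_le_neg (integral_mono (h.integrable_log_mixture hR hg) hR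
    fun x => (le_abs_self _).trans (h.abs_log_mixture_le hg x))

/-- `log t ≤ t - 1` at the ratio of the mixtures. The right side is the mean drift of `∫ log f_n · b
dF`, so that drift dominates the excess loss. -/
theorem logLoss_sub_le (h : RatioKernel r R) [IsProbabilityMeasure M] [SFinite F]
    (hR : Integrable R M) (hg : IsDensityOn F Set.univ g) (hg' : IsDensityOn F Set.univ g') :
    logLoss r F M g - logLoss r F M g'
      ≤ ∫ x, mixture r F g' x / mixture r F g x ∂M - 1 := by
  have hi : Integrable (fun x => mixture r F g' x / mixture r F g x) M :=
    hR.mono' ((h.measurable_mixture hg'.1).div (h.measurable_mixture hg.1)).aestronglyMeasurable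
      (ae_of_all _ fun x => by
        rw [Real.norm_of_nonneg (div_pos (h.mixture_pos hg' x) (h.mixture_pos hg x)).le]
        exact h.mixture_div_le hg' hg x)
  have h1 : ∫ x, (Real.log (mixture r F g' x) - Real.log (mixture r F g x)) ∂M
      ≤ ∫ x, (mixture r F g' x / mixture r F g x - 1) ∂M := by
    refine integral_mono ((h.integrable_log_mixture hR hg').sub (h.integrable_log_mixture hR hg))
      (hi.sub (integrable_const 1)) fun x => ?_
    have hx := h.mixture_pos hg x
    have hx' := h.mixture_pos hg' x
    simp only
    rw [← Real.log_div hx'.ne' hx.ne']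
    exact Real.log_le_sub_one_of_pos (div_pos hx' hx)
  rw [integral_sub (h.integrable_log_mixture hR hg') (h.integrable_log_mixture hR hg),
    integral_sub hi (integrable_const 1)] at h1
  simp only [integral_const, probReal_univ, smul_eq_mul, mul_one] at h1
  unfold logLoss
  linarith

theorem measurable_coMixture (h : RatioKernel r R) [SFinite F] (hg : Measurable g) :
    Measurable (coMixture r F g y) := by
  refine Measurable.div ?_ ((h.measurable_mixture hg).mul_const _)
  have hm : Measurable fun q : χ × E => (r q.1 q.2 * r y q.2 : ℝ) * g q.2 :=
    (h.meas.coe_nnreal_real.mul ((h.measurable_apply y).comp measurable_snd)).mul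
      (hg.comp measurable_snd)
  exact (hm.stronglyMeasurable.integral_prod_right' (ν := F)).measurable

theorem integrable_coMixture (h : RatioKernel r R) [IsFiniteMeasure M] [SFinite F]
    (hg : IsDensityOn F Set.univ g) : Integrable (coMixture r F g y) M :=
  Integrable.of_bound (h.measurable_coMixture hg.1).aestronglyMeasurable (R y)
    (ae_of_all _ fun x => by
      rw [Real.norm_of_nonneg (h.coMixture_nonneg hg y x)]
      exact h.coMixture_le hg y x)

theorem integral_coMixture_mem (h : RatioKernel r R) [IsProbabilityMeasure M] [SFinite F]
    (hg : IsDensityOn F Set.univ g) (y : χ) :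
    0 ≤ ∫ x, coMixture r F g y x ∂M ∧ ∫ x, coMixture r F g y x ∂M ≤ R y := by
  refine ⟨integral_nonneg fun x => h.coMixture_nonneg hg y x, ?_⟩
  calc _ ≤ ∫ _, R y ∂M := integral_mono (h.integrable_coMixture hg) (integrable_const _)
          fun x => h.coMixture_le hg y x
    _ = R y := by simp

/-- A step multiplies the mixture at `x` by `1 + v (coMixture - 1)`, and `|coMixture - 1| ≤ R y`
because `0 ≤ coMixture ≤ R y` and `R y ≥ 1`. -/
theorem logLoss_recursionStep_le (h : RatioKernel r R) [IsProbabilityMeasure M] [SFinite F]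
    (hR : Integrable R M) (hg : IsDensityOn F Set.univ g) (hv : 0 < v) (hv' : v ≤ 1 / 2) :
    logLoss r F M (recursionStep r F v y g)
      ≤ logLoss r F M g - v * (∫ x, coMixture r F g y x ∂M - 1) + 2 * v ^ 2 * R y ^ 2 := by
  have hg' := h.isDensityOn_recursionStep hg ⟨hv, by linarith⟩ (y := y)
  have hco := h.integrable_coMixture hg (M := M) (y := y)
  have hco1 : Integrable (fun x => v * (coMixture r F g y x - 1) - 2 * v ^ 2 * R y ^ 2) M :=
    ((hco.sub (integrable_const 1)).const_mul v).sub (integrable_const _)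
  have hco2 : Integrable (fun x => v * (coMixture r F g y x - 1)) M :=
    (hco.sub (integrable_const 1)).const_mul v
  have hpt : ∀ x, Real.log (mixture r F g x)
        + (v * (coMixture r F g y x - 1) - 2 * v ^ 2 * R y ^ 2)
      ≤ Real.log (mixture r F (recursionStep r F v y g) x) := by
    intro x
    have h1 := h.coMixture_nonneg hg y x
    have h2 := h.coMixture_le hg y x
    have h3 := h.one_le y
    have ht : -(1 / 2) ≤ v * (coMixture r F g y x - 1) := by nlinarith [mul_nonneg hv.le h1]
    rw [h.mixture_recursionStep hg, Real.log_mul (h.mixture_pos hg x).ne' (by linarith)]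
    have h4 := sub_two_mul_sq_le_log ht
    have h5 : (coMixture r F g y x - 1) ^ 2 ≤ R y ^ 2 :=
      sq_le_sq' (by linarith) (by linarith)
    nlinarith [mul_le_mul_of_nonneg_left h5 (sq_nonneg v)]
  have h1 := integral_mono ((h.integrable_log_mixture hR hg).add hco1)
    (h.integrable_log_mixture hR hg') hpt
  simp only [Pi.add_apply] at h1
  rw [integral_add (h.integrable_log_mixture hR hg) hco1,
    integral_sub hco2 (integrable_const _),
    integral_const_mul, integral_sub hco (integrable_const 1)] at h1
  simp only [integral_const, probReal_univ, smul_eq_mul, mul_one, one_mul] at h1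
  unfold logLoss
  linarith

theorem integral_div_mixture_swap (h : RatioKernel r R) [IsProbabilityMeasure M] [SFinite F]
    (hR : Integrable R M) (hg : IsDensityOn F Set.univ g) {k : E → ℝ} (hk : Integrable k F) :
    ∫ x, ∫ θ, (r x θ / mixture r F g x : ℝ) * k θ ∂F ∂M
      = ∫ θ, (∫ x, (r x θ / mixture r F g x : ℝ) ∂M) * k θ ∂F := by
  have hm : Measurable fun q : χ × E => (r q.1 q.2 / mixture r F g q.1 : ℝ) :=
    h.meas.coe_nnreal_real.div ((h.measurable_mixture hg.1).comp measurable_fst)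
  rw [integral_integral_swap]
  · simp_rw [integral_mul_const]
  · refine (hR.mul_prod hk.norm).mono'
      (hm.aestronglyMeasurable.mul hk.aestronglyMeasurable.comp_snd) (ae_of_all _ fun q => ?_)
    simp only [Function.uncurry, norm_mul]
    refine mul_le_mul_of_nonneg_right ?_ (norm_nonneg _)
    rw [Real.norm_of_nonneg (div_nonneg (h.pos _ _).le (h.mixture_pos hg _).le)]
    exact h.div_mixture_le hg _ _

/-- By Fubini the double integral is `∫ A² g dF`, where `A(θ)` is the mean of `r(x|θ) / m_g(x)`
under `M` and `∫ A g dF = 1`; then Jensen's inequality. -/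
theorem one_le_integral_integral_coMixture (h : RatioKernel r R) [IsProbabilityMeasure M]
    [SFinite F] (hR : Integrable R M) (hg : IsDensityOn F Set.univ g) :
    1 ≤ ∫ y, ∫ x, coMixture r F g y x ∂M ∂M := by
  set A : E → ℝ := fun θ => ∫ x, (r x θ / mixture r F g x : ℝ) ∂M with hA
  have hm : Measurable fun q : E × χ => (r q.2 q.1 / mixture r F g q.2 : ℝ) :=
    (h.meas.comp measurable_swap).coe_nnreal_real.div
      ((h.measurable_mixture hg.1).comp measurable_snd)
  have hAm : Measurable A := (hm.stronglyMeasurable.integral_prod_right' (ν := M)).measurable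
  have hA0 : ∀ θ, 0 ≤ A θ := fun θ =>
    integral_nonneg fun x => div_nonneg (h.pos _ _).le (h.mixture_pos hg _).le
  have hAb : ∀ θ, A θ ≤ ∫ x, R x ∂M := by
    intro θ
    refine integral_mono (hR.mono' (hm.comp measurable_prodMk_left).aestronglyMeasurable
      (ae_of_all _ fun x => ?_)) hR fun x => h.div_mixture_le hg _ _
    rw [Real.norm_of_nonneg (div_nonneg (h.pos _ _).le (h.mixture_pos hg _).le)]
    exact h.div_mixture_le hg _ _
  have hAi : ∀ {k : E → ℝ}, Integrable k F → Integrable (fun θ => A θ * k θ) F := fun hk =>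
    hk.bdd_mul (c := ∫ x, R x ∂M) hAm.aestronglyMeasurable
      (ae_of_all _ fun θ => by rw [Real.norm_of_nonneg (hA0 θ)]; exact hAb θ)
  have hone : ∫ θ, A θ * g θ ∂F = 1 := by
    rw [← h.integral_div_mixture_swap hR hg hg.integrable]
    have : ∀ x, ∫ θ, (r x θ / mixture r F g x : ℝ) * g θ ∂F = 1 := by
      intro x
      simp_rw [div_mul_eq_mul_div]
      rw [integral_div, ← mixture, div_self (h.mixture_pos hg x).ne']
    simp [this]
  have hinner : ∀ y, ∫ x, coMixture r F g y x ∂M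
      = ∫ θ, (r y θ / mixture r F g y : ℝ) * (A θ * g θ) ∂F := by
    intro y
    have h1 := h.integral_div_mixture_swap hR hg
      ((h.integrable_mul hg.integrable y).div_const (mixture r F g y))
    calc ∫ x, coMixture r F g y x ∂M
        = ∫ x, ∫ θ, (r x θ / mixture r F g x : ℝ) * (r y θ * g θ / mixture r F g y) ∂F ∂M := by
          refine integral_congr_ae (ae_of_all _ fun x => ?_)
          simp only [coMixture]
          rw [← integral_div]
          refine integral_congr_ae (ae_of_all _ fun θ => ?_)
          have := (h.mixture_pos hg x).ne'
          have := (h.mixture_pos hg y).ne'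
          field_simp
      _ = ∫ θ, A θ * (r y θ * g θ / mixture r F g y) ∂F := h1
      _ = _ := by
          refine integral_congr_ae (ae_of_all _ fun θ => ?_)
          simp only
          ring
  simp_rw [hinner]
  rw [h.integral_div_mixture_swap hR hg (hAi hg.integrable)]
  -- Jensen in the elementary form `2A - 1 ≤ A²`.
  have h2 : ∫ θ, (2 * (A θ * g θ) - g θ) ∂F ≤ ∫ θ, A θ * (A θ * g θ) ∂F := by
    refine integral_mono (((hAi hg.integrable).const_mul 2).sub hg.integrable)
      (hAi (hAi hg.integrable)) fun θ => ?_
    simp only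
    nlinarith [mul_nonneg (sq_nonneg (A θ - 1)) (hg.2.1 θ)]
  rw [integral_sub ((hAi hg.integrable).const_mul 2) hg.integrable, integral_const_mul, hone,
    hg.integral_eq_one] at h2
  linarith

/-- The factor is a convex combination of 1 and `r / m_g`, both of which lie in `[1/R, R]`. -/
theorem step_factor_bounds (h : RatioKernel r R) (hg : IsDensityOn F Set.univ g)
    (hv : 0 < v ∧ v ≤ 1) (θ : E) :
    1 + v * (r y θ / mixture r F g y - 1) ≤ R y ∧
      1 ≤ R y * (1 + v * (r y θ / mixture r F g y - 1)) := by
  have h1 := h.div_mixture_le hg y θ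
  have h2 : 1 ≤ R y * (r y θ / mixture r F g y) := by
    rw [← mul_div_assoc, one_le_div (h.mixture_pos hg y)]
    exact h.mixture_le_mul hg y θ
  have h3 := h.one_le y
  have := mul_le_mul_of_nonneg_left h1 hv.1.le
  have := mul_le_mul_of_nonneg_left h2 hv.1.le
  have := mul_le_mul_of_nonneg_left h3 (sub_nonneg.2 hv.2)
  constructor <;> nlinarith

/-- Averaging the second order expansion of the step factor against `b` turns `r(y|θ)` into
`m_b(y)`. -/
theorem integral_mul_log_recursionStep_ge (h : RatioKernel r R) (hg : IsDensityOn F Set.univ g)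
    (hpos : ∀ θ, 0 < g θ) (hb : IsDensityOn F Set.univ b) (hv : 0 < v) (hv' : v ≤ 1 / 2)
    (hi : Integrable (fun θ => Real.log (g θ) * b θ) F) :
    ∫ θ, Real.log (g θ) * b θ ∂F
        + (v * (mixture r F b y / mixture r F g y - 1) - 2 * v ^ 2 * R y ^ 2)
      ≤ ∫ θ, Real.log (recursionStep r F v y g θ) * b θ ∂F := by
  have hbd := h.step_factor_bounds hg (y := y) ⟨hv, by linarith⟩
  have hfpos : ∀ θ, 0 < 1 + v * (r y θ / mixture r F g y - 1 : ℝ) := fun θ => by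
    have h1 := (hbd θ).2
    have h2 := h.bound_pos y
    by_contra hn
    nlinarith [mul_nonpos_of_nonneg_of_nonpos h2.le (not_lt.1 hn)]
  have hlog : ∀ θ, Real.log (recursionStep r F v y g θ) * b θ = Real.log (g θ) * b θ
      + Real.log (1 + v * (r y θ / mixture r F g y - 1 : ℝ)) * b θ := fun θ => by
    rw [h.recursionStep_eq hg, Real.log_mul (hpos θ).ne' (hfpos θ).ne', add_mul]
  have hfi : Integrable
      (fun θ => Real.log (1 + v * (r y θ / mixture r F g y - 1 : ℝ)) * b θ) F := by
    refine hb.integrable.bdd_mul (c := R y) (Real.measurable_log.comp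
      (((((h.measurable_apply y).div_const _).sub_const _).const_mul _).const_add
        _)).aestronglyMeasurable (ae_of_all _ fun θ => ?_)
    exact h.abs_log_le (hbd θ).1 (hbd θ).2
  simp_rw [hlog]
  rw [integral_add hi hfi]
  refine add_le_add_right ?_ _
  have hlow : Integrable (fun θ => (v / mixture r F g y) * (r y θ * b θ)
      - (v + 2 * v ^ 2 * R y ^ 2) * b θ) F :=
    ((h.integrable_mul hb.integrable y).const_mul _).sub (hb.integrable.const_mul _)
  have h1 : ∫ θ, ((v / mixture r F g y) * (r y θ * b θ)
      - (v + 2 * v ^ 2 * R y ^ 2) * b θ) ∂F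
      ≤ ∫ θ, Real.log (1 + v * (r y θ / mixture r F g y - 1 : ℝ)) * b θ ∂F := by
    refine integral_mono hlow hfi fun θ => ?_
    have h2 := h.neg_one_le_sub_one hg (y := y) θ
    have h3 := h.div_mixture_le hg y θ
    have h4 := h.one_le y
    have ht : -(1 / 2) ≤ v * (r y θ / mixture r F g y - 1 : ℝ) := by
      nlinarith [mul_le_mul_of_nonneg_left h2 hv.le]
    have h5 := sub_two_mul_sq_le_log ht
    have h6 : (r y θ / mixture r F g y - 1 : ℝ) ^ 2 ≤ R y ^ 2 :=
      sq_le_sq' (by linarith) (by linarith)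
    have h7 : v * (r y θ / mixture r F g y - 1 : ℝ) - 2 * v ^ 2 * R y ^ 2
        ≤ Real.log (1 + v * (r y θ / mixture r F g y - 1 : ℝ)) := by
      nlinarith [mul_le_mul_of_nonneg_left h6 (sq_nonneg v)]
    calc _ = (v * (r y θ / mixture r F g y - 1 : ℝ) - 2 * v ^ 2 * R y ^ 2) * b θ := by ring
      _ ≤ _ := mul_le_mul_of_nonneg_right h7 (hb.2.1 θ)
  rw [integral_sub ((h.integrable_mul hb.integrable y).const_mul _) (hb.integrable.const_mul _),
    integral_const_mul, integral_const_mul, hb.integral_eq_one, ← mixture] at h1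
  refine le_trans (le_of_eq ?_) h1
  ring

end RatioKernel

/-! ### Dependent observations and delayed scores -/

/-- The sequence of the observations `X 1, X 2, …`, frozen after time `k`. -/
def stoppedObs {Ω χ : Type*} (X : ℕ → Ω → χ) (k : ℕ) (ω : Ω) (i : ℕ) : χ :=
  -- The maximum keeps `X 0` out, about which nothing is assumed.
  X (max 1 (min i k)) ω

theorem stoppedObs_apply {Ω χ : Type*} {X : ℕ → Ω → χ} {i k : ℕ} (hi : 1 ≤ i) (hik : i ≤ k) (ω : Ω) :
    stoppedObs X k ω i = X i ω := by
  rw [stoppedObs, min_eq_left hik, max_eq_right hi]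

section Observations

variable {Ω χ : Type*} [mΩ : MeasurableSpace Ω] [mχ : MeasurableSpace χ] {P : Measure Ω}
  {X : ℕ → Ω → χ} {M : Measure χ} {R : χ → ℝ} {w : ℕ → ℝ}

theorem measurable_stoppedObs (hX : ∀ i, 1 ≤ i → Measurable (X i)) (k : ℕ) :
    Measurable (stoppedObs X k) :=
  measurable_pi_lambda _ fun _ => hX _ (le_max_left _ _)

/-- The filtration generated by the observations `X 1, X 2, …`. -/
def obsFiltration (X : ℕ → Ω → χ) (hX : ∀ i, 1 ≤ i → Measurable (X i)) : Filtration ℕ mΩ where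
  seq k := MeasurableSpace.comap (stoppedObs X k) MeasurableSpace.pi
  mono' := by
    intro k k' h
    have : stoppedObs X k = (fun (z : ℕ → χ) i => z (max 1 (min i k))) ∘ stoppedObs X k' := by
      ext ω i
      simp only [stoppedObs, Function.comp]
      congr 1
      omega
    change MeasurableSpace.comap (stoppedObs X k) _ ≤ MeasurableSpace.comap (stoppedObs X k') _
    rw [this, ← MeasurableSpace.comap_comp]
    exact MeasurableSpace.comap_mono
      (measurable_pi_lambda _ fun i => measurable_pi_apply _).comap_le
  le' k := (measurable_stoppedObs hX k).comap_le

theorem IsMDependent.indepFun_stoppedObs {q : ℕ} (hq : 1 ≤ q) (hdep : IsMDependent (q - 1) X P)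
    {k : ℕ} (hk : 1 ≤ k) : IndepFun (stoppedObs X k) (X (k + q)) P := by
  rw [IndepFun_iff_Indep]
  refine indep_of_indep_of_le_left (indep_of_indep_of_le_right (hdep k hk) ?_) ?_
  · exact le_iSup₂_of_le (f := fun j (_ : j ∈ Set.Ici (k + (q - 1) + 1)) => mχ.comap (X j))
      (k + q) (by simp only [Set.mem_Ici]; omega) le_rfl
  · rw [MeasurableSpace.pi, MeasurableSpace.comap_iSup]
    refine iSup_le fun i => ?_
    rw [MeasurableSpace.comap_comp]
    refine le_iSup₂_of_le (f := fun j (_ : j ∈ Set.Icc 1 k) => mχ.comap (X j))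
      (max 1 (min i k)) ⟨le_max_left _ _, by omega⟩ le_rfl

/-- By independence the past and `X (k + q)` have a product law, so integrating first over the new
observation gives 0 on every event of the past. -/
theorem condExp_sub_integral_eq_zero [IsProbabilityMeasure P] {q : ℕ} (hq : 1 ≤ q) (hX : ∀ i, 1 ≤ i → Measurable (X i))
    (hlaw : ∀ i, 1 ≤ i → P.map (X i) = M) (hdep : IsMDependent (q - 1) X P) {k : ℕ} (hk : 1 ≤ k)
    {c : (ℕ → χ) → χ → ℝ} (hc : Measurable (Function.uncurry c)) (hc0 : ∀ z y, 0 ≤ c z y)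
    (hcR : ∀ z y, c z y ≤ R y) (hR : Integrable R M) :
    P[fun ω => c (stoppedObs X k ω) (X (k + q) ω) - ∫ y, c (stoppedObs X k ω) y ∂M
      | obsFiltration X hX k] =ᵐ[P] 0 := by
  have hXn := hX (k + q) (by omega)
  have hZ := measurable_stoppedObs hX k
  have hM : IsProbabilityMeasure M := hlaw 1 le_rfl ▸ Measure.isProbabilityMeasure_map
    (hX 1 le_rfl).aemeasurable
  have hprod : P.map (fun ω => (stoppedObs X k ω, X (k + q) ω)) = (P.map (stoppedObs X k)).prod M := by
    rw [(indepFun_iff_map_prod_eq_prod_map_map hZ.aemeasurable hXn.aemeasurable).1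
      (hdep.indepFun_stoppedObs hq hk), hlaw _ (by omega)]
  have hZp : IsProbabilityMeasure (P.map (stoppedObs X k)) :=
    Measure.isProbabilityMeasure_map hZ.aemeasurable
  set D : (ℕ → χ) × χ → ℝ := fun s => c s.1 s.2 - ∫ y, c s.1 y ∂M with hD
  have hcm : Measurable fun z => ∫ y, c z y ∂M :=
    (hc.stronglyMeasurable.integral_prod_right' (ν := M)).measurable
  have hDm : Measurable D := hc.sub (hcm.comp measurable_fst)
  have hci : ∀ z, Integrable (c z) M := fun z =>
    hR.mono' (hc.comp measurable_prodMk_left).aestronglyMeasurable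
      (ae_of_all _ fun y => by rw [Real.norm_of_nonneg (hc0 z y)]; exact hcR z y)
  have hint : ∀ z, 0 ≤ ∫ y, c z y ∂M ∧ ∫ y, c z y ∂M ≤ ∫ y, R y ∂M := fun z =>
    ⟨integral_nonneg (hc0 z), integral_mono (hci z) hR (hcR z)⟩
  have hDi : Integrable D ((P.map (stoppedObs X k)).prod M) := by
    refine ((hR.comp_snd _).add (integrable_const (∫ y, R y ∂M))).mono'
      hDm.aestronglyMeasurable (ae_of_all _ fun s => ?_)
    have h1 := hint s.1
    have h2 := hc0 s.1 s.2
    have h3 := hcR s.1 s.2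
    simp only [hD, Real.norm_eq_abs, Pi.add_apply]
    rw [abs_le]
    constructor <;> linarith
  have hDP : Integrable (fun ω => D (stoppedObs X k ω, X (k + q) ω)) P := by
    rw [← hprod] at hDi
    exact hDi.comp_measurable (hZ.prodMk hXn)
  refine (ae_eq_condExp_of_forall_setIntegral_eq ((obsFiltration X hX).le k) hDP
    (fun s _ _ => integrableOn_zero) ?_ aestronglyMeasurable_const).symm
  rintro s ⟨B, hB, rfl⟩ -
  have h1 : ∫ ω in stoppedObs X k ⁻¹' B, D (stoppedObs X k ω, X (k + q) ω) ∂P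
      = ∫ s in B ×ˢ Set.univ, D s ∂(P.map (fun ω => (stoppedObs X k ω, X (k + q) ω))) := by
    rw [setIntegral_map (hB.prod MeasurableSet.univ) hDm.aestronglyMeasurable
      (hZ.prodMk hXn).aemeasurable]
    congr 2
    ext ω
    simp
  rw [h1, hprod, setIntegral_prod _ hDi.integrableOn]
  have h2 : ∀ z, ∫ y, D (z, y) ∂M = 0 := fun z => by
    simp only [hD]
    rw [integral_sub (hci z) (integrable_const _)]
    simp
  simp [h2]

/-- The expected sum is `∑ w_i² · ∫ R² dM`, which is finite; no independence enters. The term `i =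
0` is split off because `X 0` is arbitrary. -/
theorem ae_summable_weighted_sq (hX : ∀ i, 1 ≤ i → Measurable (X i))
    (hlaw : ∀ i, 1 ≤ i → P.map (X i) = M) (hRm : Measurable R)
    (hR : Integrable (fun x => R x ^ 2) M) (hw : Summable fun i => w i ^ 2) :
    ∀ᵐ ω ∂P, Summable fun i => (w i * R (X i ω)) ^ 2 := by
  have hterm : ∀ i, ∫⁻ ω, ENNReal.ofReal ((w (i + 1) * R (X (i + 1) ω)) ^ 2) ∂P
      = ENNReal.ofReal (w (i + 1) ^ 2 * ∫ x, R x ^ 2 ∂M) := by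
    intro i
    rw [← integral_const_mul,
      ofReal_integral_eq_lintegral_ofReal (hR.const_mul _) (ae_of_all _ fun x => by positivity),
      ← hlaw (i + 1) (by omega), lintegral_map (by fun_prop) (hX _ (by omega))]
    simp only [mul_pow]
  have hfin : ∫⁻ ω, ∑' i, ENNReal.ofReal ((w (i + 1) * R (X (i + 1) ω)) ^ 2) ∂P ≠ ∞ := by
    rw [lintegral_tsum fun i => by
      have := hX (i + 1) (by omega)
      fun_prop]
    simp_rw [hterm]
    rw [← ENNReal.ofReal_tsum_of_nonneg (fun i => by positivity)
      (((summable_nat_add_iff 1).2 hw).mul_right _)]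
    exact ENNReal.ofReal_ne_top
  have hmeas : AEMeasurable
      (fun ω => ∑' i, ENNReal.ofReal ((w (i + 1) * R (X (i + 1) ω)) ^ 2)) P := by
    refine AEMeasurable.tsum fun i => ?_
    have := hX (i + 1) (by omega)
    fun_prop
  filter_upwards [ae_lt_top' hmeas hfin] with ω hω
  rw [← summable_nat_add_iff 1]
  refine (ENNReal.summable_toReal hω.ne).congr fun i => ?_
  rw [ENNReal.toReal_ofReal (sq_nonneg _)]

theorem sub_sum_le_of_le_succ {c d : ℕ → ℝ} (h : ∀ k, c k - d k ≤ c (k + 1)) (k j : ℕ) :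
    c k - ∑ i ∈ Finset.range j, d (k + i) ≤ c (k + j) := by
  induction j with
  | zero => simp
  | succ j ih =>
    rw [Finset.sum_range_succ]
    have := h (k + j)
    rw [← add_assoc]
    linarith

/-- Almost surely the weighted scores `w_n c_{n-1}(X, X_n)` are bounded below by the weighted
`q`-step-delayed mean scores, up to a convergent series. -/
theorem ae_exists_score_ge [IsProbabilityMeasure P] {q : ℕ} (hq : 1 ≤ q) (hX : ∀ i, 1 ≤ i → Measurable (X i))
    (hlaw : ∀ i, 1 ≤ i → P.map (X i) = M) (hdep : IsMDependent (q - 1) X P)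
    (hRm : Measurable R) (hR1 : ∀ x, 1 ≤ R x) (hR : Integrable (fun x => R x ^ 2) M)
    (hw : ∀ i, 1 ≤ i → 0 < w i ∧ w i ≤ 1) (hw2 : Summable fun i => w i ^ 2)
    {c : ℕ → (ℕ → χ) → χ → ℝ} (hc : ∀ k, Measurable (Function.uncurry (c k)))
    (hc0 : ∀ k z y, 0 ≤ c k z y) (hcR : ∀ k z y, c k z y ≤ R y)
    (hcausal : ∀ k z z', (∀ i, 1 ≤ i → i ≤ k → z i = z' i) → c k z = c k z')
    (hstep : ∀ k z y, c k z y - 3 * w (k + 1) * R (z (k + 1)) * R y ≤ c (k + 1) z y) :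
    ∀ᵐ ω ∂P, ∃ e : ℕ → ℝ, (∃ l, Tendsto (fun n => ∑ i ∈ Finset.range n, e i) atTop (𝓝 l)) ∧
      ∀ k, 1 ≤ k → w (k + q) * ∫ y, c k (fun i => X i ω) y ∂M - e k
        ≤ w (k + q) * c (k + q - 1) (fun i => X i ω) (X (k + q) ω) := by
  have hM : IsProbabilityMeasure M := hlaw 1 le_rfl ▸ Measure.isProbabilityMeasure_map
    (hX 1 le_rfl).aemeasurable
  have hRi : Integrable R M := hR.mono' hRm.aestronglyMeasurable (ae_of_all _ fun x => by
    have := hR1 x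
    rw [Real.norm_of_nonneg (by linarith)]
    nlinarith)
  have hcm : ∀ k, Measurable fun z => ∫ y, c k z y ∂M := fun k =>
    ((hc k).stronglyMeasurable.integral_prod_right' (ν := M)).measurable
  have hci : ∀ k z, Integrable (c k z) M := fun k z =>
    hRi.mono' ((hc k).comp measurable_prodMk_left).aestronglyMeasurable
      (ae_of_all _ fun y => by rw [Real.norm_of_nonneg (hc0 k z y)]; exact hcR k z y)
  have hint : ∀ k z, 0 ≤ ∫ y, c k z y ∂M ∧ ∫ y, c k z y ∂M ≤ ∫ y, R y ∂M := fun k z =>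
    ⟨integral_nonneg (hc0 k z), integral_mono (hci k z) hRi (hcR k z)⟩
  have hRX : ∀ n, 1 ≤ n → MemLp (fun ω => R (X n ω)) 2 P := by
    intro n hn
    have h1 : MemLp R 2 M := (memLp_two_iff_integrable_sq hRm.aestronglyMeasurable).2 hR
    rw [← hlaw n hn] at h1
    exact h1.comp_of_map (hX n hn).aemeasurable
  have hRX2 : ∀ n, 1 ≤ n → ∫ ω, R (X n ω) ^ 2 ∂P = ∫ x, R x ^ 2 ∂M := by
    intro n hn
    rw [← hlaw n hn, integral_map (hX n hn).aemeasurable (by fun_prop)]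
  set D : ℕ → Ω → ℝ := fun k ω => c k (stoppedObs X k ω) (X (k + q) ω)
    - ∫ y, c k (stoppedObs X k ω) y ∂M with hD
  have hDm : ∀ k, Measurable (D k) := fun k =>
    ((hc k).comp ((measurable_stoppedObs hX k).prodMk (hX (k + q) (by omega)))).sub
      ((hcm k).comp (measurable_stoppedObs hX k))
  have hDb : ∀ k ω, |D k ω| ≤ R (X (k + q) ω) + ∫ y, R y ∂M := by
    intro k ω
    have h1 := hint k (stoppedObs X k ω)
    have h2 := hc0 k (stoppedObs X k ω) (X (k + q) ω)
    have h3 := hcR k (stoppedObs X k ω) (X (k + q) ω)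
    rw [abs_le]
    constructor <;> simp only [hD] <;> linarith
  have hDL : ∀ k, MemLp (D k) 2 P := fun k =>
    ((hRX (k + q) (by omega)).add (memLp_const (∫ y, R y ∂M))).mono
      (hDm k).aestronglyMeasurable (ae_of_all _ fun ω => by
        have h := hDb k ω
        rw [Real.norm_eq_abs]
        exact h.trans (le_abs_self _))
  -- The term `k = 0` is dropped, since independence is available only for blocks `X 1, …, X k` with
  -- `k ≥ 1`.
  set Y : ℕ → Ω → ℝ := fun k => if 1 ≤ k then fun ω => w (k + q) * D k ω else 0 with hY
  have hYconv : ∀ᵐ ω ∂P, ∃ l, Tendsto (fun n => ∑ i ∈ Finset.range n, Y i ω) atTop (𝓝 l) := by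
    refine ae_tendsto_sum_of_condExp_lag_eq_zero (obsFiltration X hX) Y hq (fun k => ?_)
      (fun k => ?_) (fun k => ?_) ?_
    · simp only [hY]
      split_ifs with hk
      · have hH : Measurable fun z : ℕ → χ =>
            w (k + q) * (c k z (z (k + q)) - ∫ y, c k z y ∂M) :=
          (((hc k).comp (measurable_id.prodMk (measurable_pi_apply _))).sub (hcm k)).const_mul _
        -- As `c k` sees nothing after time `k`, freezing the observations at `k + q` gives the same
        -- value and also exhibits `X (k + q)`.
        have heq : (fun ω => w (k + q) * D k ω)
            = (fun z : ℕ → χ => w (k + q) * (c k z (z (k + q)) - ∫ y, c k z y ∂M))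
              ∘ stoppedObs X (k + q) := by
          ext ω
          have h1 : c k (stoppedObs X k ω) = c k (stoppedObs X (k + q) ω) :=
            hcausal k _ _ fun i hi hik => by
              rw [stoppedObs_apply hi hik, stoppedObs_apply hi (by omega)]
          simp only [hD, Function.comp, h1]
          rw [stoppedObs_apply (by omega) le_rfl]
        rw [heq]
        exact (hH.comp (comap_measurable _)).stronglyMeasurable
      · exact stronglyMeasurable_zero
    · simp only [hY]
      split_ifs with hk
      · exact (hDL k).const_mul _
      · exact MemLp.zero
    · simp only [hY]
      split_ifs with hk
      · have h1 := condExp_sub_integral_eq_zero hq hX hlaw hdep hk (hc k) (hc0 k) (hcR k) hRi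
        have h2 := condExp_smul (μ := P) (w (k + q)) (D k) (obsFiltration X hX k)
        have h3 : (fun ω => w (k + q) * D k ω) = w (k + q) • D k := by ext; simp
        rw [h3]
        filter_upwards [h1, h2] with ω h1 h2
        rw [h2, Pi.smul_apply, h1]
        simp
      · rw [condExp_zero]
    · refine Summable.of_nonneg_of_le (fun k => integral_nonneg fun ω => sq_nonneg _)
        (fun k => ?_) (((summable_nat_add_iff q).2 hw2).mul_right
          (2 * ∫ x, R x ^ 2 ∂M + 2 * (∫ y, R y ∂M) ^ 2))
      simp only [hY]
      split_ifs with hk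
      · simp only [mul_pow]
        rw [integral_const_mul]
        refine mul_le_mul_of_nonneg_left ?_ (sq_nonneg _)
        have hi := (hRX (k + q) (by omega)).integrable_sq.const_mul 2
        calc ∫ ω, D k ω ^ 2 ∂P
            ≤ ∫ ω, (2 * R (X (k + q) ω) ^ 2 + 2 * (∫ y, R y ∂M) ^ 2) ∂P := by
              refine integral_mono (hDL k).integrable_sq (hi.add (integrable_const _))
                fun ω => ?_
              have h1 := hDb k ω
              have h2 := pow_le_pow_left₀ (abs_nonneg _) h1 2
              rw [sq_abs] at h2
              simp only
              nlinarith [sq_nonneg (R (X (k + q) ω) - ∫ y, R y ∂M)]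
          _ = _ := by
              rw [integral_add hi (integrable_const _), integral_const_mul,
                hRX2 _ (by omega)]
              simp
      · simp only [Pi.zero_apply, ne_eq, OfNat.ofNat_ne_zero, not_false_eq_true, zero_pow,
          integral_zero]
        have : 0 ≤ ∫ x, R x ^ 2 ∂M := integral_nonneg fun x => sq_nonneg _
        positivity
  filter_upwards [hYconv, ae_summable_weighted_sq hX hlaw hRm hR hw2] with ω ⟨l, hl⟩ hs
  set z : ℕ → χ := fun i => X i ω with hz
  -- The price of the delay: the `q - 1` steps from `c k` to `c (k + q - 1)`, each estimated by
  -- `hstep`.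
  set err : ℕ → ℝ := fun k => ∑ i ∈ Finset.range (q - 1),
    3 * ((w (k + i + 1) * R (z (k + i + 1))) * (w (k + q) * R (z (k + q)))) with herr
  have herrs : Summable err := by
    refine summable_sum fun i _ => ?_
    refine Summable.of_norm_bounded (g := fun k => 3 * ((w (k + i + 1) * R (z (k + i + 1))) ^ 2
      + (w (k + q) * R (z (k + q))) ^ 2)) ?_ fun k => ?_
    · have h1 := (summable_nat_add_iff (i + 1)).2 hs
      have h2 := (summable_nat_add_iff q).2 hs
      exact (h1.add h2).mul_left 3
    · rw [Real.norm_eq_abs, abs_le]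
      constructor <;> nlinarith [
        sq_nonneg (w (k + i + 1) * R (z (k + i + 1)) + w (k + q) * R (z (k + q))),
        sq_nonneg (w (k + i + 1) * R (z (k + i + 1)) - w (k + q) * R (z (k + q)))]
  refine ⟨fun k => err k - Y k ω, ⟨(∑' k, err k) - l, ?_⟩, fun k hk => ?_⟩
  · simp_rw [Finset.sum_sub_distrib]
    exact herrs.hasSum.tendsto_sum_nat.sub hl
  · have hwk := (hw (k + q) (by omega)).1
    have h2 : c k z (z (k + q)) - ∑ i ∈ Finset.range (q - 1),
        3 * w (k + i + 1) * R (z (k + i + 1)) * R (z (k + q)) ≤ c (k + (q - 1)) z (z (k + q)) :=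
      sub_sum_le_of_le_succ (c := fun j => c j z (z (k + q)))
        (d := fun j => 3 * w (j + 1) * R (z (j + 1)) * R (z (k + q)))
        (fun j => hstep j z (z (k + q))) k (q - 1)
    have h3 : c k (stoppedObs X k ω) = c k z :=
      hcausal k _ _ fun i hi hik => stoppedObs_apply hi hik ω
    have h4 : Y k ω = w (k + q) * (c k z (z (k + q)) - ∫ y, c k z y ∂M) := by
      simp only [hY, if_pos hk, hD, h3]
      rfl
    have h5 : err k = w (k + q) * ∑ i ∈ Finset.range (q - 1),
        3 * w (k + i + 1) * R (z (k + i + 1)) * R (z (k + q)) := by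
      rw [herr, Finset.mul_sum]
      exact Finset.sum_congr rfl fun i _ => by ring
    rw [show k + q - 1 = k + (q - 1) by omega]
    have h6 := mul_le_mul_of_nonneg_left h2 hwk.le
    change _ - (err k - Y k ω) ≤ _
    rw [h4, h5]
    change _ ≤ w (k + q) * c (k + (q - 1)) z (z (k + q))
    linarith

end Observations

/-! ### Limit of the loss along the recursion -/

theorem predictiveRecursion_succ {χ E : Type*} [MeasurableSpace E] (p : χ → E → ℝ≥0)
    (μ : Measure E) (w : ℕ → ℝ) (f₀ : E → ℝ) (z : ℕ → χ) (n : ℕ) :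
    predictiveRecursion p μ w f₀ z (n + 1)
      = recursionStep p μ (w (n + 1)) (z (n + 1)) (predictiveRecursion p μ w f₀ z n) := rfl

theorem predictiveRecursion_congr {χ E : Type*} [MeasurableSpace E] (p : χ → E → ℝ≥0)
    (μ : Measure E) (w : ℕ → ℝ) (f₀ : E → ℝ) {z z' : ℕ → χ} {n : ℕ}
    (h : ∀ i, 1 ≤ i → i ≤ n → z i = z' i) :
    predictiveRecursion p μ w f₀ z n = predictiveRecursion p μ w f₀ z' n := by
  induction n with
  | zero => rfl
  | succ n ih =>
    rw [predictiveRecursion_succ, predictiveRecursion_succ,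
      ih fun i hi hin => h i hi (by omega), h (n + 1) (by omega) le_rfl]

/-- After subtraction of the partial sums of `a` the sequence is non-increasing from `k₀` on and
bounded below. -/
theorem tendsto_of_le_add_of_tendsto_sum {u a : ℕ → ℝ} {k₀ : ℕ} {l b : ℝ}
    (h : ∀ k, k₀ ≤ k → u (k + 1) ≤ u k + a k) (hb : ∀ k, b ≤ u k)
    (ha : Tendsto (fun n => ∑ i ∈ Finset.range n, a i) atTop (𝓝 l)) :
    ∃ l', Tendsto u atTop (𝓝 l') := by
  set s : ℕ → ℝ := fun n => ∑ i ∈ Finset.range n, a i with hs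
  have hanti : Antitone fun k => u (k + k₀) - s (k + k₀) := by
    refine antitone_nat_of_succ_le fun k => ?_
    have h1 := h (k + k₀) (by omega)
    have h2 : s (k + 1 + k₀) = s (k + k₀) + a (k + k₀) := by
      rw [show k + 1 + k₀ = (k + k₀) + 1 by omega, hs]
      exact Finset.sum_range_succ _ _
    rw [h2, show k + 1 + k₀ = (k + k₀) + 1 by omega]
    linarith
  have ha' := (tendsto_add_atTop_iff_nat k₀).2 ha
  obtain ⟨C, hC⟩ := ha'.bddAbove_range
  have hbdd : BddBelow (Set.range fun k => u (k + k₀) - s (k + k₀)) := by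
    refine ⟨b - C, ?_⟩
    rintro _ ⟨k, rfl⟩
    have h1 : s (k + k₀) ≤ C := hC ⟨k, rfl⟩
    have := hb (k + k₀)
    simp only
    linarith
  refine ⟨_, (tendsto_add_atTop_iff_nat k₀).1
    (((tendsto_atTop_ciInf hanti hbdd).add ha').congr fun k => ?_)⟩
  simp [hs]

/-- If `l'` exceeded `J`, then `u - J` would eventually stay above some `δ > 0`, and `φ` would grow
like `δ ∑ v`, which its upper bound forbids. -/
theorem le_of_sum_bounded {φ u a v : ℕ → ℝ} {k₀ : ℕ} {l l' J B : ℝ}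
    (hφ : ∀ k, k₀ ≤ k → φ k + v k * (u k - J) - a k ≤ φ (k + 1)) (hB : ∀ k, φ k ≤ B)
    (hv : ∀ k, k₀ ≤ k → 0 ≤ v k) (hvs : ¬ Summable v) (hu : Tendsto u atTop (𝓝 l'))
    (ha : Tendsto (fun n => ∑ i ∈ Finset.range n, a i) atTop (𝓝 l)) : l' ≤ J := by
  by_contra! hlt
  obtain ⟨δ, hδ, hδ'⟩ : ∃ δ, 0 < δ ∧ J + δ < l' := ⟨(l' - J) / 2, by linarith, by linarith⟩
  obtain ⟨k₁, hk₁⟩ := eventually_atTop.1 (hu.eventually_const_lt hδ')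
  set K := max k₀ k₁ with hK
  obtain ⟨C, hC⟩ := ha.bddAbove_range
  apply hvs
  rw [← summable_nat_add_iff K]
  have hsum : ∀ n, φ K + δ * ∑ i ∈ Finset.range n, v (i + K)
      - ∑ i ∈ Finset.range n, a (i + K) ≤ φ (n + K) := by
    intro n
    induction n with
    | zero => simp
    | succ n ih =>
      rw [Finset.sum_range_succ, Finset.sum_range_succ, show n + 1 + K = (n + K) + 1 by omega]
      have h1 := hφ (n + K) (by omega)
      have h2 := hv (n + K) (by omega)
      have h3 := hk₁ (n + K) (by omega)
      nlinarith [mul_le_mul_of_nonneg_left (by linarith : δ ≤ u (n + K) - J) h2]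
  refine summable_of_sum_range_le (c := (B - φ K + C - ∑ i ∈ Finset.range K, a i) / δ)
    (fun n => hv _ (by omega)) fun n => ?_
  rw [le_div_iff₀ hδ]
  have h1 := hsum n
  have h2 := hB (n + K)
  have h3 : ∑ i ∈ Finset.range (n + K), a i ≤ C := hC ⟨n + K, rfl⟩
  have h4 : ∑ i ∈ Finset.range (n + K), a i
      = ∑ i ∈ Finset.range K, a i + ∑ i ∈ Finset.range n, a (i + K) := by
    rw [add_comm n K, Finset.sum_range_add]
    simp [add_comm]
  linarith

/-- `log g ≤ g` and `b ≤ C`. This is where boundedness of the comparison density is needed. -/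
theorem integral_log_mul_le {E : Type*} [MeasurableSpace E] {F : Measure E} {g b : E → ℝ}
    (hg : IsDensityOn F Set.univ g) (hpos : ∀ θ, 0 < g θ)
    (hb : IsDensityOn F Set.univ b) {C : ℝ} (hC : ∀ θ, b θ ≤ C)
    (hi : Integrable (fun θ => Real.log (g θ) * b θ) F) :
    ∫ θ, Real.log (g θ) * b θ ∂F ≤ C := by
  calc ∫ θ, Real.log (g θ) * b θ ∂F ≤ ∫ θ, C * g θ ∂F := by
        refine integral_mono hi (hg.integrable.const_mul C) fun θ => ?_
        have h1 := Real.log_le_sub_one_of_pos (hpos θ)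
        have h2 := mul_le_mul_of_nonneg_right h1 (hb.2.1 θ)
        have h3 := mul_le_mul_of_nonneg_right (hC θ) (hpos θ).le
        have := hb.2.1 θ
        simp only
        linarith
    _ = C := by rw [integral_const_mul, hg.integral_eq_one, mul_one]

namespace RatioKernel

variable {χ E : Type*} [mχ : MeasurableSpace χ] [MeasurableSpace E] {r : χ → E → ℝ≥0} {R : χ → ℝ}
  {F : Measure E} [IsProbabilityMeasure F] {w : ℕ → ℝ} {b : E → ℝ} {M : Measure χ}

theorem isDensityOn_predictiveRecursion (h : RatioKernel r R)
    (hw : ∀ i, 1 ≤ i → 0 < w i ∧ w i ≤ 1) (z : ℕ → χ) (n : ℕ) :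
    IsDensityOn F Set.univ (predictiveRecursion r F w (fun _ => 1) z n) := by
  induction n with
  | zero =>
    exact isDensityOn_univ_of_integral_eq_one measurable_const (fun _ => zero_le_one)
      (integrable_const 1) (integral_const (1 : ℝ) |>.trans (by simp))
  | succ n ih => exact h.isDensityOn_recursionStep ih (hw _ (by omega))

/-- The bound depends on `n` and on the observations; it only serves to make `log f_n · b`
integrable. -/
theorem log_predictiveRecursion_bounded (h : RatioKernel r R)
    (hw : ∀ i, 1 ≤ i → 0 < w i ∧ w i ≤ 1) (z : ℕ → χ) (n : ℕ) :
    (∀ θ, 0 < predictiveRecursion r F w (fun _ => 1) z n θ) ∧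
      ∃ B, ∀ θ, |Real.log (predictiveRecursion r F w (fun _ => 1) z n θ)| ≤ B := by
  induction n with
  | zero => exact ⟨fun θ => one_pos, 0, fun θ => by simp [predictiveRecursion]⟩
  | succ n ih =>
    obtain ⟨hpos, B, hB⟩ := ih
    have hd := h.isDensityOn_predictiveRecursion (F := F) hw z n
    have hbd := h.step_factor_bounds hd (y := z (n + 1)) (hw (n + 1) (by omega))
    have hfpos : ∀ θ, 0 < 1 + w (n + 1) * (r (z (n + 1)) θ
        / mixture r F (predictiveRecursion r F w (fun _ => 1) z n) (z (n + 1)) - 1 : ℝ) :=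
      fun θ => by
        have h1 := (hbd θ).2
        have h2 := h.bound_pos (z (n + 1))
        by_contra hn
        nlinarith [mul_nonpos_of_nonneg_of_nonpos h2.le (not_lt.1 hn)]
    refine ⟨fun θ => ?_, B + R (z (n + 1)), fun θ => ?_⟩
    · rw [predictiveRecursion_succ, h.recursionStep_eq hd]
      exact mul_pos (hpos θ) (hfpos θ)
    · rw [predictiveRecursion_succ, h.recursionStep_eq hd,
        Real.log_mul (hpos θ).ne' (hfpos θ).ne']
      exact (abs_add_le _ _).trans (add_le_add (hB θ) (h.abs_log_le (hbd θ).1 (hbd θ).2))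

theorem measurable_predictiveRecursion (h : RatioKernel r R) (n : ℕ) :
    Measurable fun s : (ℕ → χ) × E => predictiveRecursion r F w (fun _ => 1) s.1 n s.2 := by
  induction n with
  | zero => exact measurable_const
  | succ n ih =>
    have hs : Measurable fun s : (ℕ → χ) × E => (s.1 (n + 1), s.2) :=
      ((measurable_pi_apply (n + 1)).comp measurable_fst).prodMk measurable_snd
    have hr : Measurable fun s : (ℕ → χ) × E => (r (s.1 (n + 1)) s.2 : ℝ) :=
      (h.meas.comp hs).coe_nnreal_real
    have hm : Measurable fun z : ℕ → χ =>
        mixture r F (predictiveRecursion r F w (fun _ => 1) z n) (z (n + 1)) :=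
      ((hr.mul ih).stronglyMeasurable.integral_prod_right' (ν := F)).measurable
    exact (ih.const_mul _).add (((hr.mul ih).div (hm.comp measurable_fst)).const_mul _)

theorem measurable_mixture_predictiveRecursion (h : RatioKernel r R) (n : ℕ) :
    Measurable fun s : (ℕ → χ) × χ =>
      mixture r F (predictiveRecursion r F w (fun _ => 1) s.1 n) s.2 := by
  have hm : Measurable fun t : ((ℕ → χ) × χ) × E =>
      (r t.1.2 t.2 : ℝ) * predictiveRecursion r F w (fun _ => 1) t.1.1 n t.2 :=
    ((h.meas.comp ((measurable_snd.comp measurable_fst).prodMk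
      measurable_snd)).coe_nnreal_real).mul
      ((h.measurable_predictiveRecursion n).comp
        ((measurable_fst.comp measurable_fst).prodMk measurable_snd))
  exact (hm.stronglyMeasurable.integral_prod_right' (ν := F)).measurable

theorem measurable_integral_coMixture (h : RatioKernel r R) [SFinite M] (n : ℕ) :
    Measurable fun s : (ℕ → χ) × χ =>
      ∫ x, coMixture r F (predictiveRecursion r F w (fun _ => 1) s.1 n) s.2 x ∂M := by
  have hS := h.measurable_mixture_predictiveRecursion (F := F) (w := w) n
  have hN : Measurable fun t : (((ℕ → χ) × χ) × χ) × E => (r t.1.2 t.2 * r t.1.1.2 t.2 : ℝ)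
      * predictiveRecursion r F w (fun _ => 1) t.1.1.1 n t.2 :=
    (((h.meas.comp ((measurable_snd.comp measurable_fst).prodMk
        measurable_snd)).coe_nnreal_real).mul
      ((h.meas.comp ((measurable_snd.comp (measurable_fst.comp measurable_fst)).prodMk
        measurable_snd)).coe_nnreal_real)).mul
      ((h.measurable_predictiveRecursion n).comp
        ((measurable_fst.comp (measurable_fst.comp measurable_fst)).prodMk measurable_snd))
  have hc : Measurable fun t : ((ℕ → χ) × χ) × χ =>
      coMixture r F (predictiveRecursion r F w (fun _ => 1) t.1.1 n) t.1.2 t.2 :=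
    (hN.stronglyMeasurable.integral_prod_right' (ν := F)).measurable.div
      ((hS.comp ((measurable_fst.comp measurable_fst).prodMk measurable_snd)).mul
        (hS.comp measurable_fst))
  exact (hc.stronglyMeasurable.integral_prod_right' (ν := M)).measurable

variable {Ω : Type*} [mΩ : MeasurableSpace Ω] {P : Measure Ω} [IsProbabilityMeasure P]
  {X : ℕ → Ω → χ} {q : ℕ}

/-- Almost surely the logarithmic loss of the predictive recursion mixtures converges. -/
theorem ae_tendsto_logLoss (h : RatioKernel r R) (hR : Integrable (fun x => R x ^ 2) M)
    (hq : 1 ≤ q) (hX : ∀ i, 1 ≤ i → Measurable (X i)) (hlaw : ∀ i, 1 ≤ i → P.map (X i) = M)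
    (hdep : IsMDependent (q - 1) X P) (hw : ∀ i, 1 ≤ i → 0 < w i ∧ w i ≤ 1)
    (hw0 : Tendsto w atTop (𝓝 0)) (hw2 : Summable fun i => w i ^ 2) :
    ∀ᵐ ω ∂P, ∃ l, Tendsto (fun n => logLoss r F M
      (predictiveRecursion r F w (fun _ => 1) (fun i => X i ω) n)) atTop (𝓝 l) := by
  have hM : IsProbabilityMeasure M := hlaw 1 le_rfl ▸ Measure.isProbabilityMeasure_map
    (hX 1 le_rfl).aemeasurable
  have hRi := h.integrable_bound hR
  set L : (ℕ → χ) → ℕ → E → ℝ := fun z n => predictiveRecursion r F w (fun _ => 1) z n with hL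
  have hd : ∀ z n, IsDensityOn F Set.univ (L z n) := h.isDensityOn_predictiveRecursion hw
  have hscore := ae_exists_score_ge hq hX hlaw hdep h.meas_bound h.one_le hR hw hw2
    (c := fun k z y => ∫ x, coMixture r F (L z k) y x ∂M)
    (fun k => h.measurable_integral_coMixture k)
    (fun k z y => (h.integral_coMixture_mem (hd z k) y).1)
    (fun k z y => (h.integral_coMixture_mem (hd z k) y).2)
    (fun k z z' hz => by simp only [hL, predictiveRecursion_congr r F w _ hz])
    (fun k z y => by
      have h1 := fun x => h.coMixture_recursionStep_ge (hd z k) (hw (k + 1) (by omega))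
        (y₀ := z (k + 1)) y x
      have h2 := integral_mono ((h.integrable_coMixture (hd z k) (M := M) (y := y)).sub
        (integrable_const (3 * w (k + 1) * R (z (k + 1)) * R y)))
        (h.integrable_coMixture (hd z (k + 1)) (M := M) (y := y)) h1
      simp only [Pi.sub_apply] at h2
      rw [integral_sub (h.integrable_coMixture (hd z k)) (integrable_const _)] at h2
      simpa using h2)
  obtain ⟨N, hN⟩ := eventually_atTop.1 (hw0.eventually_le_const (u := 1 / 2) (by norm_num))
  filter_upwards [hscore, ae_summable_weighted_sq hX hlaw h.meas_bound hR hw2]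
    with ω ⟨e, ⟨l, hl⟩, he⟩ hs
  set z : ℕ → χ := fun i => X i ω with hz
  have hs' : Summable fun k => 2 * (w (k + q) * R (z (k + q))) ^ 2 :=
    ((summable_nat_add_iff q).2 hs).mul_left 2
  -- Index `k` stands for the step that uses `X (k + q)`, from `L z (k + q - 1)` to `L z (k + q)`;
  -- its score is compared with the mean score at `L z k`.
  have hconv : ∃ l', Tendsto (fun k => logLoss r F M (L z (k + (q - 1)))) atTop (𝓝 l') := by
    refine tendsto_of_le_add_of_tendsto_sum (k₀ := max 1 N)
      (a := fun k => e k + 2 * (w (k + q) * R (z (k + q))) ^ 2) (fun k hk => ?_)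
      (fun k => h.neg_integral_bound_le_logLoss hRi (hd z _)) (by
        simp_rw [Finset.sum_add_distrib]
        exact hl.add hs'.hasSum.tendsto_sum_nat)
    have hk1 : 1 ≤ k := (le_max_left _ _).trans hk
    have hkN : N ≤ k + q := (le_max_right _ _).trans (hk.trans (by omega))
    have h1 := h.logLoss_recursionStep_le hRi (hd z (k + (q - 1))) (hw (k + q) (by omega)).1
      (hN _ hkN) (y := z (k + q))
    have h2 := he k hk1
    -- The mean score is at least 1, so the drift of the loss is not positive and only summable
    -- errors remain.
    have h3 := h.one_le_integral_integral_coMixture hRi (hd z k)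
    have h4 := mul_le_mul_of_nonneg_left h3 (hw (k + q) (by omega)).1.le
    have h5 : L z (k + 1 + (q - 1))
        = recursionStep r F (w (k + q)) (z (k + q)) (L z (k + (q - 1))) := by
      rw [show k + 1 + (q - 1) = k + (q - 1) + 1 by omega]
      simp only [hL]
      rw [predictiveRecursion_succ, show k + (q - 1) + 1 = k + q by omega]
    rw [show k + q - 1 = k + (q - 1) by omega] at h2
    rw [h5, mul_pow]
    change _ ≤ w (k + q) * ∫ x, coMixture r F (L z (k + (q - 1))) (z (k + q)) x ∂M at h2
    linarith
  obtain ⟨l', hl'⟩ := hconv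
  exact ⟨l', (tendsto_add_atTop_iff_nat (q - 1)).1 hl'⟩

/-- Almost surely the limiting logarithmic loss of the predictive recursion mixtures is at most the
loss of the mixture with a given bounded mixing density. -/
theorem ae_limit_logLoss_le (h : RatioKernel r R) (hR : Integrable (fun x => R x ^ 2) M)
    (hq : 1 ≤ q) (hX : ∀ i, 1 ≤ i → Measurable (X i)) (hlaw : ∀ i, 1 ≤ i → P.map (X i) = M)
    (hdep : IsMDependent (q - 1) X P) (hw : ∀ i, 1 ≤ i → 0 < w i ∧ w i ≤ 1)
    (hw0 : Tendsto w atTop (𝓝 0)) (hw1 : ¬ Summable w) (hw2 : Summable fun i => w i ^ 2)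
    (hb : IsDensityOn F Set.univ b) {C : ℝ} (hC : ∀ θ, b θ ≤ C) :
    ∀ᵐ ω ∂P, ∀ l, Tendsto (fun n => logLoss r F M
      (predictiveRecursion r F w (fun _ => 1) (fun i => X i ω) n)) atTop (𝓝 l) →
      l ≤ logLoss r F M b := by
  have hM : IsProbabilityMeasure M := hlaw 1 le_rfl ▸ Measure.isProbabilityMeasure_map
    (hX 1 le_rfl).aemeasurable
  have hRi := h.integrable_bound hR
  set L : (ℕ → χ) → ℕ → E → ℝ := fun z n => predictiveRecursion r F w (fun _ => 1) z n with hL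
  have hd : ∀ z n, IsDensityOn F Set.univ (L z n) := h.isDensityOn_predictiveRecursion hw
  have hscore := ae_exists_score_ge hq hX hlaw hdep h.meas_bound h.one_le hR hw hw2
    (c := fun k z y => mixture r F b y / mixture r F (L z k) y)
    (fun k => ((h.measurable_mixture hb.1).comp measurable_snd).div
      (h.measurable_mixture_predictiveRecursion k))
    (fun k z y => (div_pos (h.mixture_pos hb y) (h.mixture_pos (hd z k) y)).le)
    (fun k z y => h.mixture_div_le hb (hd z k) y)
    (fun k z z' hz => by simp only [hL, predictiveRecursion_congr r F w _ hz])
    (fun k z y => h.mixture_div_recursionStep_ge (hd z k) hb (hw (k + 1) (by omega)) y)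
  obtain ⟨N, hN⟩ := eventually_atTop.1 (hw0.eventually_le_const (u := 1 / 2) (by norm_num))
  filter_upwards [hscore, ae_summable_weighted_sq hX hlaw h.meas_bound hR hw2]
    with ω ⟨e, ⟨l, hl⟩, he⟩ hs l' hl'
  set z : ℕ → χ := fun i => X i ω with hz
  have hs' : Summable fun k => 2 * (w (k + q) * R (z (k + q))) ^ 2 :=
    ((summable_nat_add_iff q).2 hs).mul_left 2
  have hpos : ∀ n θ, 0 < L z n θ := fun n => (h.log_predictiveRecursion_bounded hw z n).1
  have hi : ∀ n, Integrable (fun θ => Real.log (L z n θ) * b θ) F := by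
    intro n
    obtain ⟨B, hB⟩ := (h.log_predictiveRecursion_bounded (F := F) hw z n).2
    exact hb.integrable.bdd_mul (c := B) (Real.measurable_log.comp (hd z n).1).aestronglyMeasurable
      (ae_of_all _ hB)
  refine le_of_sum_bounded (k₀ := max 1 N) (B := C) (v := fun k => w (k + q))
    (φ := fun k => ∫ θ, Real.log (L z (k + (q - 1)) θ) * b θ ∂F)
    (a := fun k => e k + 2 * (w (k + q) * R (z (k + q))) ^ 2) (fun k hk => ?_)
    (fun k => integral_log_mul_le (hd z _) (hpos _) hb hC (hi _))
    (fun k hk => (hw (k + q) (by omega)).1.le) (fun hsum => hw1 ((summable_nat_add_iff q).1 hsum))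
    hl' (by
      simp_rw [Finset.sum_add_distrib]
      exact hl.add hs'.hasSum.tendsto_sum_nat)
  have hk1 : 1 ≤ k := (le_max_left _ _).trans hk
  have hkN : N ≤ k + q := (le_max_right _ _).trans (hk.trans (by omega))
  have h1 := h.integral_mul_log_recursionStep_ge (hd z (k + (q - 1))) (hpos _) hb
    (hw (k + q) (by omega)).1 (hN _ hkN) (hi _) (y := z (k + q))
  have h2 := he k hk1
  -- The excess loss that enters is that of the delayed density `L z k`, whose losses have the same
  -- limit.
  have h3 := h.logLoss_sub_le hRi (hd z k) hb
  have h4 := mul_le_mul_of_nonneg_left h3 (hw (k + q) (by omega)).1.le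
  have h5 : L z (k + 1 + (q - 1))
      = recursionStep r F (w (k + q)) (z (k + q)) (L z (k + (q - 1))) := by
    rw [show k + 1 + (q - 1) = k + (q - 1) + 1 by omega]
    simp only [hL]
    rw [predictiveRecursion_succ, show k + (q - 1) + 1 = k + q by omega]
  rw [show k + q - 1 = k + (q - 1) by omega] at h2
  rw [h5, mul_pow]
  change _ ≤ w (k + q) * (mixture r F b (z (k + q))
    / mixture r F (L z (k + (q - 1))) (z (k + q))) at h2
  change _ + w (k + q) * (logLoss r F M (L z k) - _) - _ ≤ _
  linarith

end RatioKernel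

/-! ### Approximation by bounded mixing densities -/

section Smoothing

variable {E : Type*} [PseudoMetricSpace E] [MeasurableSpace E]
  {F Q : Measure E} {K : Set E} {δ : ℝ}

open Classical in
/-- The density with respect to `F` of the normalised restriction of `F` to the ball of radius `δ`
around the point `s.1` of `K`. -/
noncomputable def ballKernel (F : Measure E) (K : Set E) (δ : ℝ) (s : E × E) : ℝ :=
  if s.1 ∈ K ∧ dist s.2 s.1 < δ then (F.real (Metric.ball s.1 δ))⁻¹ else 0

/-- The density with respect to `F` of the measure that arises from `Q` by spreading the mass at each
point of `K` over the ball of radius `δ`. -/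
noncomputable def smoothedDensity (F Q : Measure E) (K : Set E) (δ : ℝ) (θ' : E) : ℝ :=
  ∫ θ, ballKernel F K δ (θ, θ') ∂Q

theorem ballKernel_nonneg (s : E × E) : 0 ≤ ballKernel F K δ s := by
  unfold ballKernel
  split_ifs
  · positivity
  · exact le_rfl

/-- Finitely many balls of radius `δ / 2` cover `K`, and each `δ`-ball centred in `K` contains one
of them; so the masses of the `δ`-balls are bounded away from 0. -/
theorem exists_ballKernel_le (hK : IsCompact K)
    (hsupp : ∀ θ ∈ K, ∀ δ, 0 < δ → 0 < F (Metric.ball θ δ)) [IsFiniteMeasure F] (hδ : 0 < δ) :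
    ∃ C, ∀ s, ballKernel F K δ s ≤ C := by
  obtain ⟨t, htK, ht⟩ := hK.elim_nhds_subcover (fun θ => Metric.ball θ (δ / 2))
    fun θ _ => Metric.ball_mem_nhds θ (by positivity)
  refine ⟨∑ θ ∈ t, (F.real (Metric.ball θ (δ / 2)))⁻¹, fun s => ?_⟩
  have hnn : ∀ θ ∈ t, 0 ≤ (F.real (Metric.ball θ (δ / 2)))⁻¹ := fun θ _ => by positivity
  unfold ballKernel
  split_ifs with h
  · obtain ⟨θ, hθ, hθs⟩ := Set.mem_iUnion₂.1 (ht h.1)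
    refine le_trans ?_ (Finset.single_le_sum hnn hθ)
    have hpos : 0 < F.real (Metric.ball θ (δ / 2)) :=
      ENNReal.toReal_pos (hsupp θ (htK θ hθ) _ (by positivity)).ne' (measure_ne_top _ _)
    refine inv_anti₀ hpos (measureReal_mono fun y hy => ?_)
    rw [Metric.mem_ball] at hy hθs ⊢
    have := dist_triangle_right y s.1 θ
    linarith
  · exact Finset.sum_nonneg hnn

variable [BorelSpace E]

theorem measurable_ballKernel [SecondCountableTopology E] [SFinite F] (hK : MeasurableSet K) :
    Measurable (ballKernel F K δ) := by
  have hs : MeasurableSet {s : E × E | dist s.2 s.1 < δ} :=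
    measurableSet_lt (measurable_snd.dist measurable_fst) measurable_const
  have hm : Measurable fun θ => F (Metric.ball θ δ) := measurable_measure_prodMk_left hs
  exact Measurable.ite ((measurable_fst hK).inter hs)
    ((hm.ennreal_toReal.comp measurable_fst).inv) measurable_const

theorem integral_ballKernel [IsFiniteMeasure F]
    (hsupp : ∀ θ ∈ K, ∀ δ, 0 < δ → 0 < F (Metric.ball θ δ)) (hδ : 0 < δ) {θ : E} (hθ : θ ∈ K) :
    ∫ θ', ballKernel F K δ (θ, θ') ∂F = 1 := by
  have : (fun θ' => ballKernel F K δ (θ, θ'))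
      = (Metric.ball θ δ).indicator fun _ => (F.real (Metric.ball θ δ))⁻¹ := by
    ext θ'
    simp [ballKernel, Set.indicator, hθ]
  rw [this, integral_indicator_const _ Metric.isOpen_ball.measurableSet, smul_eq_mul]
  exact mul_inv_cancel₀ (ENNReal.toReal_pos (hsupp θ hθ δ hδ).ne' (measure_ne_top _ _)).ne'

variable [SecondCountableTopology E] [IsProbabilityMeasure F] [IsProbabilityMeasure Q]

theorem integral_mul_smoothedDensity (hK : IsCompact K) (hKm : MeasurableSet K)
    (hsupp : ∀ θ ∈ K, ∀ δ, 0 < δ → 0 < F (Metric.ball θ δ)) (hδ : 0 < δ) {k : E → ℝ}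
    (hk : Measurable k) {c : ℝ} (hc : ∀ θ, |k θ| ≤ c) :
    ∫ θ', k θ' * smoothedDensity F Q K δ θ' ∂F
      = ∫ θ, ∫ θ', k θ' * ballKernel F K δ (θ, θ') ∂F ∂Q := by
  obtain ⟨C, hC⟩ := exists_ballKernel_le hK hsupp hδ
  simp_rw [smoothedDensity, ← integral_const_mul]
  rw [integral_integral_swap]
  refine Integrable.of_bound (C := c * C) ?_ (ae_of_all _ fun s => ?_)
  · exact ((hk.comp measurable_fst).mul
      ((measurable_ballKernel hKm).comp measurable_swap)).aestronglyMeasurable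
  · simp only [Function.uncurry, norm_mul, Real.norm_eq_abs]
    rw [abs_of_nonneg (ballKernel_nonneg _)]
    exact mul_le_mul (hc _) (hC _) (ballKernel_nonneg _) ((abs_nonneg _).trans (hc s.1))

theorem isDensityOn_smoothedDensity (hK : IsCompact K) (hKm : MeasurableSet K)
    (hsupp : ∀ θ ∈ K, ∀ δ, 0 < δ → 0 < F (Metric.ball θ δ)) (hQ : ∀ᵐ θ ∂Q, θ ∈ K) (hδ : 0 < δ) :
    IsDensityOn F Set.univ (smoothedDensity F Q K δ)
      ∧ ∃ C, ∀ θ, smoothedDensity F Q K δ θ ≤ C := by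
  obtain ⟨C, hC⟩ := exists_ballKernel_le hK hsupp hδ
  have hm := measurable_ballKernel (F := F) (δ := δ) hKm
  have hsm : Measurable (smoothedDensity F Q K δ) :=
    ((hm.comp measurable_swap).stronglyMeasurable.integral_prod_right' (ν := Q)).measurable
  have hki : ∀ θ', Integrable (fun θ => ballKernel F K δ (θ, θ')) Q := fun θ' =>
    Integrable.of_bound (hm.comp measurable_prodMk_right).aestronglyMeasurable C
      (ae_of_all _ fun θ => by
        rw [Real.norm_of_nonneg (ballKernel_nonneg _)]
        exact hC _)
  have h0 : ∀ θ, 0 ≤ smoothedDensity F Q K δ θ := fun θ =>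
    integral_nonneg fun _ => ballKernel_nonneg _
  have hb : ∀ θ, smoothedDensity F Q K δ θ ≤ C := fun θ' => by
    calc smoothedDensity F Q K δ θ' ≤ ∫ _, C ∂Q :=
          integral_mono (hki θ') (integrable_const C) fun θ => hC _
      _ = C := by simp
  refine ⟨isDensityOn_univ_of_integral_eq_one hsm h0 (Integrable.of_bound
    hsm.aestronglyMeasurable C (ae_of_all _ fun θ => ?_)) ?_, C, hb⟩
  · rw [Real.norm_of_nonneg (h0 θ)]
    exact hb θ
  · have h1 := integral_mul_smoothedDensity (Q := Q) hK hKm hsupp hδ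
      (measurable_const (a := (1 : ℝ))) (c := 1) (fun _ => by simp)
    simp only [one_mul] at h1
    rw [h1]
    calc _ = ∫ _, (1 : ℝ) ∂Q := integral_congr_ae (by
          filter_upwards [hQ] with θ hθ using integral_ballKernel hsupp hδ hθ)
      _ = 1 := by simp

/-- By Fubini the integral is the `Q`-mean of averages of `k` over small balls around `θ`. Since `F`
lives on `K`, only values of `k` on `K` enter, and continuity on `K` gives pointwise convergence;
the bound on `k` gives domination. -/
theorem tendsto_integral_smoothedDensity (hK : IsCompact K) (hKm : MeasurableSet K)
    (hsupp : ∀ θ ∈ K, ∀ δ, 0 < δ → 0 < F (Metric.ball θ δ)) (hF : ∀ᵐ θ ∂F, θ ∈ K)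
    (hQ : ∀ᵐ θ ∂Q, θ ∈ K) {k : E → ℝ} (hk : Measurable k) {c : ℝ} (hc : ∀ θ, |k θ| ≤ c)
    (hcont : ContinuousOn k K) {δ : ℕ → ℝ} (hδ : ∀ n, 0 < δ n) (hδ0 : Tendsto δ atTop (𝓝 0)) :
    Tendsto (fun n => ∫ θ', k θ' * smoothedDensity F Q K (δ n) θ' ∂F) atTop
      (𝓝 (∫ θ, k θ ∂Q)) := by
  have hmk : ∀ n, Measurable (ballKernel F K (δ n)) := fun n => measurable_ballKernel hKm
  have hbi : ∀ n θ, Integrable (fun θ' => ballKernel F K (δ n) (θ, θ')) F := fun n θ => by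
    obtain ⟨C, hC⟩ := exists_ballKernel_le hK hsupp (hδ n)
    refine Integrable.of_bound ((hmk n).comp measurable_prodMk_left).aestronglyMeasurable C
      (ae_of_all _ fun θ' => ?_)
    rw [Real.norm_of_nonneg (ballKernel_nonneg _)]
    exact hC _
  have hdev : ∀ n, ∀ θ ∈ K, ∀ ε, (∀ θ' ∈ K, dist θ' θ < δ n → |k θ' - k θ| ≤ ε) →
      |∫ θ', k θ' * ballKernel F K (δ n) (θ, θ') ∂F - k θ| ≤ ε := by
    intro n θ hθ ε hε
    have h1 : k θ = ∫ θ', k θ * ballKernel F K (δ n) (θ, θ') ∂F := by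
      rw [integral_const_mul, integral_ballKernel hsupp (hδ n) hθ, mul_one]
    have hi1 : Integrable (fun θ' => k θ' * ballKernel F K (δ n) (θ, θ')) F :=
      (hbi n θ).bdd_mul (c := c) hk.aestronglyMeasurable (ae_of_all _ hc)
    conv_lhs => rw [h1]
    rw [← integral_sub hi1 ((hbi n θ).const_mul _), ← Real.norm_eq_abs]
    calc _ ≤ ∫ θ', ε * ballKernel F K (δ n) (θ, θ') ∂F := by
          refine norm_integral_le_of_norm_le ((hbi n θ).const_mul ε) ?_
          filter_upwards [hF] with θ' hθ'
          rw [← sub_mul, norm_mul, Real.norm_of_nonneg (ballKernel_nonneg _), Real.norm_eq_abs]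
          by_cases hd : dist θ' θ < δ n
          · exact mul_le_mul_of_nonneg_right (hε θ' hθ' hd) (ballKernel_nonneg _)
          · simp [ballKernel, hd]
      _ = ε := by rw [integral_const_mul, integral_ballKernel hsupp (hδ n) hθ, mul_one]
  have hrw : ∀ n, ∫ θ', k θ' * smoothedDensity F Q K (δ n) θ' ∂F
      = ∫ θ, ∫ θ', k θ' * ballKernel F K (δ n) (θ, θ') ∂F ∂Q := fun n =>
    integral_mul_smoothedDensity hK hKm hsupp (hδ n) hk hc
  simp_rw [hrw]
  refine tendsto_integral_of_dominated_convergence (fun _ => 3 * c) (fun n => ?_)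
    (integrable_const _) (fun n => ?_) ?_
  · exact (((hk.comp measurable_snd).mul (hmk n)).stronglyMeasurable.integral_prod_right'
      (ν := F)).aestronglyMeasurable
  · filter_upwards [hQ] with θ hθ
    have h1 := hdev n θ hθ (2 * c) fun θ' _ _ => by
      have := abs_sub (k θ') (k θ)
      have := hc θ
      have := hc θ'
      linarith
    have h2 := hc θ
    rw [abs_le] at h1 h2
    rw [Real.norm_eq_abs, abs_le]
    constructor <;> linarith
  · filter_upwards [hQ] with θ hθ
    rw [Metric.tendsto_atTop]
    intro ε hε
    obtain ⟨η, hη, hη'⟩ := Metric.continuousOn_iff.1 hcont θ hθ (ε / 2) (by positivity)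
    obtain ⟨N, hN⟩ := eventually_atTop.1 (hδ0.eventually_lt_const hη)
    refine ⟨N, fun n hn => ?_⟩
    rw [Real.dist_eq]
    refine (hdev n θ hθ (ε / 2) fun θ' hθ' hd => ?_).trans_lt (by linarith)
    exact (hη' θ' hθ' (hd.trans (hN n hn))).le

end Smoothing

/-! ### The ratio bound from the moment and kernel conditions -/

theorem exists_pos_of_mixture_pos {χ E : Type*} [MeasurableSpace E] {p : χ → E → ℝ≥0}
    {μ : Measure E} {S : Set E} {f : E → ℝ} {x : χ} (hf : IsDensityOn μ S f) (h : 0 < mixture p μ f x) :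
    ∃ θ ∈ S, 0 < p x θ := by
  by_contra! hn
  refine h.ne' (integral_eq_zero_of_ae ?_)
  filter_upwards [hf.2.2.1] with θ hθ
  by_cases hS : θ ∈ S
  · simp [le_antisymm (hn θ hS) zero_le]
  · simp [hθ hS]

/-- `R x` bounds the ratios of the kernel values at the points of `T`, for `x` in a measurable set `G`
of full measure for the density `m`. -/
structure RatioBound {χ E : Type*} [MeasurableSpace χ] (p : χ → E → ℝ≥0) (ν : Measure χ) (m : χ → ℝ) (T : Set E) (G : Set χ)
    (R : χ → ℝ) : Prop where
  measurableSet : MeasurableSet G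
  ae_mem : ∀ᵐ x ∂(densityMeasure ν m), x ∈ G
  meas_bound : Measurable R
  one_le : ∀ x, 1 ≤ R x
  integrable_sq : Integrable (fun x => R x ^ 2) (densityMeasure ν m)
  pos : ∀ x ∈ G, 0 < m x
  kernel_pos : ∀ x ∈ G, ∀ θ ∈ T, 0 < p x θ
  ratio : ∀ x ∈ G, ∀ θ ∈ T, ∀ θ' ∈ T, (p x θ : ℝ) ≤ R x * p x θ'

section Kernel

variable {χ E : Type*} [MeasurableSpace χ] [MeasurableSpace E] {p : χ → E → ℝ≥0}
  {ν : Measure χ} {μ : Measure E} {S T : Set E} {f g : E → ℝ} {x : χ}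

theorem IsDensityOn.mono (hg : IsDensityOn μ S g) (h : S ⊆ T) : IsDensityOn μ T g :=
  ⟨hg.1, hg.2.1, hg.2.2.1.mono fun _ h1 h2 => h1 fun h3 => h2 (h h3), hg.2.2.2⟩

theorem IsDensityOn.integrable_kernel_mul (hg : IsDensityOn μ S g)
    (hp : Measurable (Function.uncurry p)) (hb : BddAbove (p x '' S)) :
    Integrable (fun θ => (p x θ : ℝ) * g θ) μ := by
  obtain ⟨C, hC⟩ := hb
  refine (hg.integrable.const_mul (C : ℝ)).mono'
    ((hp.comp measurable_prodMk_left).coe_nnreal_real.mul hg.1).aestronglyMeasurable ?_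
  filter_upwards [hg.2.2.1] with θ hθ
  rw [Real.norm_of_nonneg (mul_nonneg (p x θ).coe_nonneg (hg.2.1 θ))]
  by_cases hS : θ ∈ S
  · exact mul_le_mul_of_nonneg_right (NNReal.coe_le_coe.2 (hC ⟨θ, hS, rfl⟩)) (hg.2.1 θ)
  · rw [hθ hS, mul_zero, mul_zero]

theorem IsDensityOn.ofReal_mixture (hg : IsDensityOn μ S g)
    (hp : Measurable (Function.uncurry p)) (hb : BddAbove (p x '' S)) :
    ENNReal.ofReal (mixture p μ g x) = ∫⁻ θ, (p x θ : ℝ≥0∞) * ENNReal.ofReal (g θ) ∂μ := by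
  rw [mixture, ofReal_integral_eq_lintegral_ofReal (hg.integrable_kernel_mul hp hb)
    (ae_of_all _ fun θ => mul_nonneg (p x θ).coe_nonneg (hg.2.1 θ))]
  refine lintegral_congr fun θ => ?_
  rw [ENNReal.ofReal_mul (p x θ).coe_nonneg, ENNReal.ofReal_coe_nnreal]

theorem IsDensityOn.lintegral_densityMeasure_mixture [SFinite ν] [SFinite μ]
    (hg : IsDensityOn μ S g) (hp : Measurable (Function.uncurry p))
    (hb : ∀ x, BddAbove (p x '' S)) {ρ : χ → ℝ≥0∞} (hρ : Measurable ρ) :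
    ∫⁻ x, ρ x ∂(densityMeasure ν (mixture p μ g))
      = ∫⁻ θ, (∫⁻ x, ρ x * p x θ ∂ν) * ENNReal.ofReal (g θ) ∂μ := by
  have hgm : Measurable fun θ => ENNReal.ofReal (g θ) := hg.1.ennreal_ofReal
  have hpm : Measurable fun s : χ × E => (p s.1 s.2 : ℝ≥0∞) := hp.coe_nnreal_ennreal
  have hpx : ∀ x, Measurable fun θ => (p x θ : ℝ≥0∞) := fun x => hpm.comp measurable_prodMk_left
  have hpθ : ∀ θ, Measurable fun x => (p x θ : ℝ≥0∞) := fun θ => hpm.comp measurable_prodMk_right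
  rw [densityMeasure, lintegral_withDensity_eq_lintegral_mul _
    (measurable_mixture hp hg.1).ennreal_ofReal hρ]
  simp only [Pi.mul_apply, fun x => hg.ofReal_mixture hp (hb x)]
  have h1 : ∀ x, (∫⁻ θ, (p x θ : ℝ≥0∞) * ENNReal.ofReal (g θ) ∂μ) * ρ x
      = ∫⁻ θ, (p x θ : ℝ≥0∞) * ENNReal.ofReal (g θ) * ρ x ∂μ := fun x =>
    (lintegral_mul_const _ ((hpx x).mul hgm)).symm
  have h2 : ∀ θ, (∫⁻ x, ρ x * p x θ ∂ν) * ENNReal.ofReal (g θ)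
      = ∫⁻ x, ρ x * p x θ * ENNReal.ofReal (g θ) ∂ν := fun θ =>
    (lintegral_mul_const _ (hρ.mul (hpθ θ))).symm
  simp_rw [h1, h2]
  rw [lintegral_lintegral_swap]
  · refine lintegral_congr fun θ => lintegral_congr fun x => ?_
    ring
  · exact ((hpm.mul (hgm.comp measurable_snd)).mul (hρ.comp measurable_fst)).aemeasurable

theorem IsDensityOn.isProbabilityMeasure_mixture [SFinite ν] [SFinite μ]
    (hg : IsDensityOn μ S g) (hp : Measurable (Function.uncurry p))
    (hb : ∀ x, BddAbove (p x '' S)) (h1 : ∀ θ ∈ S, ∫⁻ x, (p x θ : ℝ≥0∞) ∂ν = 1) :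
    IsProbabilityMeasure (densityMeasure ν (mixture p μ g)) := by
  constructor
  have h := hg.lintegral_densityMeasure_mixture (ν := ν) hp hb (measurable_const (a := 1))
  simp only [lintegral_one, one_mul] at h
  rw [h]
  refine (lintegral_congr_ae ?_).trans hg.2.2.2
  filter_upwards [hg.2.2.1] with θ hθ
  by_cases hS : θ ∈ S
  · rw [h1 θ hS, one_mul]
  · rw [hθ hS, ENNReal.ofReal_zero, mul_zero]

/-- The moment bound of order 2, uniform in `θ₃`, is averaged over `θ₃` with weight `f`. -/
theorem CondA4.lintegral_ratio_sq_lt_top [SFinite ν] [SFinite μ] {q : ℕ} (hq : 1 ≤ q)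
    (hp : Measurable (Function.uncurry p)) (hf : IsDensityOn μ T f)
    (hb : ∀ x, BddAbove (p x '' T)) (hA4 : CondA4 p ν q S T) {θ₁ θ₂ : E} (h1 : θ₁ ∈ S)
    (h2 : θ₂ ∈ S) :
    ∫⁻ x, ((p x θ₂ : ℝ≥0∞) / p x θ₁) ^ 2 ∂(densityMeasure ν (mixture p μ f)) < ∞ := by
  have hpθ : ∀ θ, Measurable fun x => (p x θ : ℝ≥0∞) := fun θ =>
    hp.coe_nnreal_ennreal.comp measurable_prodMk_right
  obtain ⟨B, -, hB⟩ := hA4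
  have hm : Measurable fun x => ((p x θ₂ : ℝ≥0∞) / p x θ₁) ^ 2 :=
    ((hpθ θ₂).div (hpθ θ₁)).pow_const 2
  rw [hf.lintegral_densityMeasure_mixture hp hb hm]
  calc _ ≤ ∫⁻ θ, B * ENNReal.ofReal (f θ) ∂μ := by
        refine lintegral_mono_ae ?_
        filter_upwards [hf.2.2.1] with θ hθ
        by_cases hT : θ ∈ T
        · exact mul_le_mul_left (hB 2 (by omega) θ₂ h2 θ₁ h1 θ hT).le _
        · simp [hθ hT]
    _ = B := by rw [lintegral_const_mul _ hf.1.ennreal_ofReal, hf.2.2.2, mul_one]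
    _ < ∞ := ENNReal.coe_lt_top

/-- On `χc` ratios are at most `b / a`; off `χc` they are at most `cu` times one ratio at points of
`ΘH`. Summing over all pairs of the finite set `ΘH` avoids a measurable choice of that pair. -/
theorem exists_ratioBound [SFinite ν] [SFinite μ] {q : ℕ} (hq : 1 ≤ q) {ΘH : Set E}
    {χc : Set χ} (hp : Measurable (Function.uncurry p)) (hf : IsDensityOn μ S f) (hST : S ⊆ T)
    (hb : ∀ x, BddAbove (p x '' S)) (hH : ΘH.Finite)
    (hM : IsProbabilityMeasure (densityMeasure ν (mixture p μ f)))
    (hA4 : CondA4 p ν q (T ∪ ΘH) S) (hC1 : CondC1 p T ΘH χc) (hC2 : CondC2 p T χc)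
    (hC3 : CondC3 p T χc) :
    ∃ G R, RatioBound p ν (mixture p μ f) T G R := by
  obtain ⟨cu, -, hcu⟩ := hC1
  obtain ⟨a, ha, haT⟩ := hC2
  obtain ⟨b, hbT⟩ := hC3
  set m := mixture p μ f with hm
  set M := densityMeasure ν m with hMdef
  have hmm : Measurable m := measurable_mixture hp hf.1
  have hpθ : ∀ θ, Measurable fun x => (p x θ : ℝ≥0∞) := fun θ =>
    hp.coe_nnreal_ennreal.comp measurable_prodMk_right
  have hpr : ∀ θ, Measurable fun x => (p x θ : ℝ) := fun θ =>
    hp.coe_nnreal_real.comp measurable_prodMk_right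
  have hmom : ∀ θ₁ ∈ ΘH, ∀ θ₂ ∈ ΘH, ∫⁻ x, ((p x θ₂ : ℝ≥0∞) / p x θ₁) ^ 2 ∂M < ∞ :=
    fun θ₁ h1 θ₂ h2 => hA4.lintegral_ratio_sq_lt_top hq hp hf hb (Or.inr h1) (Or.inr h2)
  -- For a vanishing denominator both sides are 0; membership in `G` below excludes the infinite
  -- ratios that this would hide.
  have htoReal : ∀ x θ₁ θ₂, ((p x θ₂ : ℝ≥0∞) / p x θ₁).toReal = (p x θ₂ / p x θ₁ : ℝ) :=
    fun x θ₁ θ₂ => by rw [ENNReal.toReal_div]; rfl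
  have hL2 : ∀ θ₁ ∈ ΘH, ∀ θ₂ ∈ ΘH, MemLp (fun x => (p x θ₂ / p x θ₁ : ℝ)) 2 M := by
    intro θ₁ h1 θ₂ h2
    refine (memLp_two_iff_integrable_sq ((hpr θ₂).div (hpr θ₁)).aestronglyMeasurable).2 ?_
    refine (integrable_toReal_of_lintegral_ne_top
      (((hpθ θ₂).div (hpθ θ₁)).pow_const 2).aemeasurable (hmom θ₁ h1 θ₂ h2).ne).congr
      (ae_of_all _ fun x => ?_)
    simp only [ENNReal.toReal_pow, Pi.div_apply, htoReal]
  set Rs : χ → ℝ := fun x => ∑ θ₁ ∈ hH.toFinset, ∑ θ₂ ∈ hH.toFinset, (p x θ₂ / p x θ₁ : ℝ)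
    with hRs
  have hRs0 : ∀ x, 0 ≤ Rs x := fun x =>
    Finset.sum_nonneg fun θ₁ _ => Finset.sum_nonneg fun θ₂ _ => by positivity
  have hRsm : Measurable Rs := Finset.measurable_fun_sum _ fun θ₁ _ =>
    Finset.measurable_fun_sum _ fun θ₂ _ => (hpr θ₂).div (hpr θ₁)
  have hRsL : MemLp Rs 2 M := memLp_finsetSum _ fun θ₁ h1 => memLp_finsetSum _ fun θ₂ h2 =>
    hL2 θ₁ (hH.mem_toFinset.1 h1) θ₂ (hH.mem_toFinset.1 h2)
  set R : χ → ℝ := fun x => (1 + b / a : ℝ) + cu * Rs x with hR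
  have hRL : MemLp R 2 M := (memLp_const (1 + b / a : ℝ)).add (hRsL.const_mul (cu : ℝ))
  set G : Set χ := {x | 0 < m x} ∩
    ⋂ θ₁ ∈ ΘH, ⋂ θ₂ ∈ ΘH, {x | (p x θ₂ : ℝ≥0∞) / p x θ₁ < ∞} with hG
  have hratio : ∀ x ∈ G, (∀ θ ∈ T, 0 < p x θ) ∧
      ∀ θ ∈ T, ∀ θ' ∈ T, (p x θ : ℝ) ≤ R x * p x θ' := by
    rintro x ⟨hx, hx'⟩
    rw [Set.mem_iInter₂] at hx'
    replace hx' : ∀ θ₁ ∈ ΘH, ∀ θ₂ ∈ ΘH, (p x θ₂ : ℝ≥0∞) / p x θ₁ < ∞ :=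
      fun θ₁ h1 θ₂ h2 => Set.mem_iInter₂.1 (hx' θ₁ h1) θ₂ h2
    have ha' : (0 : ℝ) < a := ha
    by_cases hxc : x ∈ χc
    · refine ⟨fun θ hθ => ha.trans (haT x hxc θ hθ), fun θ hθ θ' hθ' => ?_⟩
      have h1 : (a : ℝ) ≤ p x θ' := (haT x hxc θ' hθ').le
      have h2 : (p x θ : ℝ) ≤ b := (hbT x hxc θ hθ).le
      calc (p x θ : ℝ) ≤ b / a * a := by rwa [div_mul_cancel₀ _ ha'.ne']
        _ ≤ b / a * p x θ' := by gcongr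
        _ ≤ R x * p x θ' := by
            refine mul_le_mul_of_nonneg_right ?_ (p x θ').coe_nonneg
            have := mul_nonneg cu.coe_nonneg (hRs0 x)
            simp only [hR]
            linarith
    · obtain ⟨θ₁, h1, θ₂, h2, h12⟩ := hcu x hxc
      have hfin : (cu : ℝ≥0∞) * ((p x θ₂ : ℝ≥0∞) / p x θ₁) < ∞ :=
        ENNReal.mul_lt_top ENNReal.coe_lt_top (hx' θ₁ h1 θ₂ h2)
      -- Some kernel value at `x` is positive because `m x > 0`; a zero at another parameter would
      -- make the ratio infinite, against the finite bound.
      obtain ⟨θ₀, hθ₀, hθ₀p⟩ := exists_pos_of_mixture_pos hf hx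
      have hpos : ∀ θ ∈ T, 0 < p x θ := by
        intro θ hθ
        rw [pos_iff_ne_zero]
        intro h0
        have h3 := (h12 θ₀ (hST hθ₀) θ hθ).trans_lt hfin
        rw [h0, ENNReal.coe_zero, ENNReal.div_zero (by exact_mod_cast hθ₀p.ne')] at h3
        exact lt_irrefl _ h3
      refine ⟨hpos, fun θ hθ θ' hθ' => ?_⟩
      have h3 := ENNReal.toReal_mono hfin.ne (h12 θ hθ θ' hθ')
      rw [ENNReal.toReal_mul, htoReal, htoReal, ENNReal.coe_toReal] at h3
      have hp' : (0 : ℝ) < p x θ' := hpos θ' hθ'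
      rw [div_le_iff₀ hp'] at h3
      refine h3.trans (mul_le_mul_of_nonneg_right ?_ hp'.le)
      have h4 : (p x θ₂ / p x θ₁ : ℝ) ≤ Rs x := by
        refine le_trans ?_ (Finset.single_le_sum (f := fun θ₁ => ∑ θ₂ ∈ hH.toFinset,
          (p x θ₂ / p x θ₁ : ℝ)) (fun θ₁ _ => Finset.sum_nonneg fun θ₂ _ => by positivity)
          (hH.mem_toFinset.2 h1))
        exact Finset.single_le_sum (f := fun θ₂ => (p x θ₂ / p x θ₁ : ℝ))
          (fun θ₂ _ => by positivity) (hH.mem_toFinset.2 h2)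
      have h5 := mul_le_mul_of_nonneg_left h4 cu.coe_nonneg
      have h6 : (0 : ℝ) ≤ b / a := by positivity
      simp only [hR]
      linarith
  refine ⟨G, R, ?_, ?_, hRsm.const_mul _ |>.const_add _, fun x => ?_, hRL.integrable_sq,
    fun x hx => hx.1, fun x hx => (hratio x hx).1, fun x hx => (hratio x hx).2⟩
  · refine (measurableSet_lt measurable_const hmm).inter
      (MeasurableSet.biInter hH.countable fun θ₁ _ => MeasurableSet.biInter hH.countable
        fun θ₂ _ => measurableSet_lt ((hpθ θ₂).div (hpθ θ₁)) measurable_const)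
  · have h1 : ∀ᵐ x ∂M, 0 < m x := by
      rw [hMdef, densityMeasure, ae_withDensity_iff hmm.ennreal_ofReal]
      exact ae_of_all _ fun x hx => by simpa using hx
    have h2 : ∀ᵐ x ∂M, ∀ θ₁ ∈ ΘH, ∀ θ₂ ∈ ΘH, (p x θ₂ : ℝ≥0∞) / p x θ₁ < ∞ := by
      refine (ae_ball_iff hH.countable).2 fun θ₁ h1 => (ae_ball_iff hH.countable).2
        fun θ₂ h2 => ?_
      filter_upwards [ae_lt_top (((hpθ θ₂).div (hpθ θ₁)).pow_const 2) (hmom θ₁ h1 θ₂ h2).ne]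
        with x hx
      by_contra hn
      rw [not_lt, top_le_iff] at hn
      simp [hn] at hx
    filter_upwards [h1, h2] with x h1 h2
    exact ⟨h1, Set.mem_iInter₂.2 fun θ₁ hθ₁ => Set.mem_iInter₂.2 fun θ₂ hθ₂ => h2 θ₁ hθ₁ θ₂ hθ₂⟩
  · have h6 : (0 : ℝ) ≤ b / a := by positivity
    have := mul_nonneg cu.coe_nonneg (hRs0 x)
    simp only [hR]
    linarith

end Kernel

/-! ### Normalisation of the kernel and change of base measure -/

theorem IsDensityOn.nonempty {E : Type*} [MeasurableSpace E] {μ : Measure E} {S : Set E}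
    {g : E → ℝ} (hg : IsDensityOn μ S g) : S.Nonempty := by
  by_contra hn
  rw [Set.not_nonempty_iff_eq_empty] at hn
  have h0 : ∫⁻ θ, ENNReal.ofReal (g θ) ∂μ = 0 := by
    rw [lintegral_eq_zero_iff hg.1.ennreal_ofReal]
    filter_upwards [hg.2.2.1] with θ hθ
    simp [hθ (by simp [hn])]
  exact one_ne_zero (hg.2.2.2.symm.trans h0)

theorem IsDensityOn.isProbabilityMeasure {E : Type*} [MeasurableSpace E] {μ : Measure E}
    {S : Set E} {g : E → ℝ} (hg : IsDensityOn μ S g) :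
    IsProbabilityMeasure (densityMeasure μ g) :=
  ⟨by rw [densityMeasure, withDensity_apply _ MeasurableSet.univ, Measure.restrict_univ,
    hg.2.2.2]⟩

theorem IsDensityOn.ae_mem {E : Type*} [MeasurableSpace E] {μ : Measure E}
    {S : Set E} {g : E → ℝ} (hg : IsDensityOn μ S g) : ∀ᵐ θ ∂(densityMeasure μ g), θ ∈ S := by
  rw [densityMeasure, ae_withDensity_iff hg.1.ennreal_ofReal]
  filter_upwards [hg.2.2.1] with θ hθ h
  by_contra hS
  simp [hθ hS] at h

theorem integral_densityMeasure {E : Type*} [MeasurableSpace E] {μ : Measure E}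
    {S : Set E} {g : E → ℝ} (hg : IsDensityOn μ S g) (k : E → ℝ) :
    ∫ θ, k θ ∂(densityMeasure μ g) = ∫ θ, g θ * k θ ∂μ := by
  rw [densityMeasure, integral_withDensity_eq_integral_toReal_smul hg.1.ennreal_ofReal
    (ae_of_all _ fun _ => ENNReal.ofReal_lt_top)]
  refine integral_congr_ae (ae_of_all _ fun θ => ?_)
  simp only [ENNReal.toReal_ofReal (hg.2.1 θ), smul_eq_mul]

theorem IsDensityOn.mul {E : Type*} [MeasurableSpace E] {μ : Measure E} {S : Set E} {g b : E → ℝ}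
    (hg : IsDensityOn μ S g) (hb : IsDensityOn (densityMeasure μ g) Set.univ b) :
    IsDensityOn μ S (fun θ => g θ * b θ) := by
  refine ⟨hg.1.mul hb.1, fun θ => mul_nonneg (hg.2.1 θ) (hb.2.1 θ), ?_, ?_⟩
  · filter_upwards [hg.2.2.1] with θ hθ hS
    rw [hθ hS, zero_mul]
  · rw [← hb.2.2.2, densityMeasure, lintegral_withDensity_eq_lintegral_mul _
      hg.1.ennreal_ofReal hb.1.ennreal_ofReal]
    refine lintegral_congr fun θ => ?_
    rw [ENNReal.ofReal_mul (hg.2.1 θ), Pi.mul_apply]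

theorem mixture_congr_ae {χ E : Type*} [MeasurableSpace E] {p : χ → E → ℝ≥0} {μ : Measure E}
    {g g' : E → ℝ} (h : g =ᵐ[μ] g') : mixture p μ g = mixture p μ g' := by
  ext x
  refine integral_congr_ae ?_
  filter_upwards [h] with θ hθ
  rw [hθ]

open Classical in
/-- The kernel `p` divided by `m`, for `x` in `G` and with the parameters outside of `T` replaced by
`θs`. -/
noncomputable def normalizedKernel {χ E : Type*} (p : χ → E → ℝ≥0) (m : χ → ℝ) (T : Set E)
    (θs : E) (G : Set χ) (x : χ) (θ : E) : ℝ≥0 :=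
  if x ∈ G then p x (if θ ∈ T then θ else θs) / (m x).toNNReal else 1

theorem RatioBound.normalizedKernel_of_mem {χ E : Type*} [MeasurableSpace χ] {p : χ → E → ℝ≥0}
    {ν : Measure χ} {T : Set E} {m : χ → ℝ} {G : Set χ} {R : χ → ℝ} {θs θ : E} {x : χ} (h : RatioBound p ν m T G R) (hx : x ∈ G) (hθ : θ ∈ T) :
    (normalizedKernel p m T θs G x θ : ℝ) = p x θ / m x := by
  rw [normalizedKernel, if_pos hx, if_pos hθ, NNReal.coe_div,
    Real.coe_toNNReal _ (h.pos x hx).le]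

namespace RatioBound

variable {χ E : Type*} [MeasurableSpace χ] [MeasurableSpace E] {p : χ → E → ℝ≥0}
  {ν : Measure χ} {μ : Measure E} {S T : Set E} {f g b : E → ℝ} {x : χ} {m : χ → ℝ}
  {G : Set χ} {R : χ → ℝ} {θs θ : E}

theorem le_mul_mixture (h : RatioBound p ν m T G R) (hp : Measurable (Function.uncurry p))
    (hb : ∀ x, BddAbove (p x '' T)) (hg : IsDensityOn μ T g) (hx : x ∈ G) (hθ : θ ∈ T) :
    (p x θ : ℝ) ≤ R x * mixture p μ g x := by
  have hi := (hg.integrable_kernel_mul hp (hb x)).const_mul (R x)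
  rw [mixture, ← integral_const_mul]
  simp_rw [← mul_assoc] at hi ⊢
  exact hg.le_integral_mul hi fun θ' hθ' => h.ratio x hx θ hθ θ' hθ'

theorem mixture_le_mul (h : RatioBound p ν m T G R) (hp : Measurable (Function.uncurry p))
    (hb : ∀ x, BddAbove (p x '' T)) (hg : IsDensityOn μ T g) (hx : x ∈ G) (hθ : θ ∈ T) :
    mixture p μ g x ≤ R x * p x θ :=
  hg.integral_mul_le (hg.integrable_kernel_mul hp (hb x))
    fun θ' hθ' => h.ratio x hx θ' hθ' θ hθ

theorem mixture_pos (h : RatioBound p ν m T G R) (hp : Measurable (Function.uncurry p))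
    (hb : ∀ x, BddAbove (p x '' T)) (hg : IsDensityOn μ T g) (hx : x ∈ G) :
    0 < mixture p μ g x := by
  obtain ⟨θ, hθ⟩ := hg.nonempty
  have h1 : (0 : ℝ) < p x θ := h.kernel_pos x hx θ hθ
  have h2 := h.le_mul_mixture hp hb hg hx hθ
  exact pos_of_mul_pos_right (h1.trans_le h2) (zero_le_one.trans (h.one_le x))

theorem mixture_le_mul_mixture (h : RatioBound p ν m T G R)
    (hp : Measurable (Function.uncurry p)) (hb : ∀ x, BddAbove (p x '' T))
    (hf : IsDensityOn μ T f) (hg : IsDensityOn μ T g) (hx : x ∈ G) :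
    mixture p μ f x ≤ R x * mixture p μ g x :=
  hf.integral_mul_le (hf.integrable_kernel_mul hp (hb x))
    fun _ hθ => h.le_mul_mixture hp hb hg hx hθ

theorem mixture_normalizedKernel (h : RatioBound p ν m T G R) (hg : IsDensityOn μ T g)
    (b : E → ℝ) (hx : x ∈ G) :
    mixture (normalizedKernel p m T θs G) (densityMeasure μ g) b x
      = mixture p μ (fun θ => g θ * b θ) x / m x := by
  rw [mixture, integral_densityMeasure hg, mixture, ← integral_div]
  refine integral_congr_ae ?_
  filter_upwards [hg.2.2.1] with θ hθ
  by_cases hT : θ ∈ T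
  · rw [h.normalizedKernel_of_mem hx hT]
    ring
  · rw [hθ hT]
    ring

/-- Since `m` is an average of kernel values at points of `T`, bounds on ratios become two-sided
bounds on the kernel divided by `m`. The default values off `G` and off `T` make these bounds hold
everywhere. -/
theorem ratioKernel (h : RatioBound p ν (mixture p μ f) T G R) [SFinite μ]
    (hp : Measurable (Function.uncurry p)) (hb : ∀ x, BddAbove (p x '' T))
    (hT : MeasurableSet T) (hf : IsDensityOn μ T f) (hθs : θs ∈ T) :
    RatioKernel (normalizedKernel p (mixture p μ f) T θs G) R := by
  have hmem : ∀ θ, ∃ θ' ∈ T, ∀ x ∈ G,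
      (normalizedKernel p (mixture p μ f) T θs G x θ : ℝ) = p x θ' / mixture p μ f x := by
    intro θ
    by_cases hθ : θ ∈ T
    · exact ⟨θ, hθ, fun x hx => h.normalizedKernel_of_mem hx hθ⟩
    · refine ⟨θs, hθs, fun x hx => ?_⟩
      rw [normalizedKernel, if_pos hx, if_neg hθ, NNReal.coe_div,
        Real.coe_toNNReal _ (h.pos x hx).le]
  have hone : ∀ x, x ∉ G → ∀ θ, normalizedKernel p (mixture p μ f) T θs G x θ = 1 :=
    fun x hx θ => if_neg hx
  refine ⟨?_, h.meas_bound, h.one_le, fun x θ θ' => ?_, fun x θ => ?_, fun x θ => ?_⟩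
  · refine Measurable.ite (measurable_fst h.measurableSet) (Measurable.div ?_ ?_) measurable_const
    · have h1 : Measurable fun s : χ × E => (s.1, by classical exact if s.2 ∈ T then s.2 else θs) :=
        measurable_fst.prodMk (Measurable.ite (measurable_snd hT) measurable_snd measurable_const)
      exact hp.comp h1
    · exact ((measurable_mixture hp hf.1).comp measurable_fst).real_toNNReal
  all_goals by_cases hx : x ∈ G
  · obtain ⟨t, ht, htx⟩ := hmem θ
    obtain ⟨t', ht', htx'⟩ := hmem θ'
    rw [htx x hx, htx' x hx, ← mul_div_assoc]
    exact div_le_div_of_nonneg_right (h.ratio x hx t ht t' ht') (h.pos x hx).le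
  · rw [hone x hx, hone x hx]
    simpa using h.one_le x
  · obtain ⟨t, ht, htx⟩ := hmem θ
    rw [htx x hx, div_le_iff₀ (h.pos x hx)]
    exact h.le_mul_mixture hp hb hf hx ht
  · rw [hone x hx]
    simpa using h.one_le x
  · obtain ⟨t, ht, htx⟩ := hmem θ
    rw [htx x hx, ← mul_div_assoc, one_le_div (h.pos x hx)]
    exact h.mixture_le_mul hp hb hf hx ht
  · rw [hone x hx]
    simpa using h.one_le x

theorem abs_log_le (h : RatioBound p ν (mixture p μ f) T G R)
    (hp : Measurable (Function.uncurry p)) (hb : ∀ x, BddAbove (p x '' T))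
    (hf : IsDensityOn μ T f) (hg : IsDensityOn μ T g) (hx : x ∈ G) :
    |Real.log (mixture p μ f x / mixture p μ g x)| ≤ R x := by
  have h1 := h.mixture_pos hp hb hf hx
  have h2 := h.mixture_pos hp hb hg hx
  have hR := zero_lt_one.trans_le (h.one_le x)
  have h3 := h.mixture_le_mul_mixture hp hb hf hg hx
  have h4 := h.mixture_le_mul_mixture hp hb hg hf hx
  have h5 := Real.log_le_sub_one_of_pos (div_pos h1 h2)
  have h6 := Real.log_le_sub_one_of_pos (div_pos h2 h1)
  have h7 : mixture p μ f x / mixture p μ g x ≤ R x := by rwa [div_le_iff₀ h2]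
  have h8 : mixture p μ g x / mixture p μ f x ≤ R x := by rwa [div_le_iff₀ h1]
  rw [← inv_div, Real.log_inv] at h6
  rw [abs_le]
  rw [← inv_div (mixture p μ g x)] at h5 h7
  rw [← inv_div (mixture p μ g x)]
  constructor <;> simp only [inv_div] at * <;> linarith

/-- The divergence of a mixture from the true density is finite and given by the usual formula. -/
theorem klDensity_mixture (h : RatioBound p ν (mixture p μ f) T G R) [SigmaFinite ν] [SFinite μ]
    (hp : Measurable (Function.uncurry p)) (hb : ∀ x, BddAbove (p x '' T))
    (h1 : ∀ θ ∈ T, ∫⁻ x, (p x θ : ℝ≥0∞) ∂ν = 1) (hf : IsDensityOn μ T f)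
    (hg : IsDensityOn μ T g) :
    klDensity ν (mixture p μ f) (mixture p μ g) ≠ ∞ ∧
      (klDensity ν (mixture p μ f) (mixture p μ g)).toReal
        = ∫ x, Real.log (mixture p μ f x / mixture p μ g x)
          ∂(densityMeasure ν (mixture p μ f)) := by
  set M := densityMeasure ν (mixture p μ f) with hM
  set N := densityMeasure ν (mixture p μ g) with hN
  have hMp : IsProbabilityMeasure M := hf.isProbabilityMeasure_mixture hp hb h1
  have hNp : IsProbabilityMeasure N := hg.isProbabilityMeasure_mixture hp hb h1
  have hfm := measurable_mixture (μ := μ) hp hf.1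
  have hgm := measurable_mixture (μ := μ) hp hg.1
  set ρ : χ → ℝ≥0∞ := fun x => ENNReal.ofReal (mixture p μ f x / mixture p μ g x) with hρ
  have hρm : Measurable ρ := (hfm.div hgm).ennreal_ofReal
  -- Almost everywhere, either `m` vanishes, and so does the density on the right, or the point lies
  -- in `G`, where `m_g` is positive.
  have hMN : M = N.withDensity ρ := by
    rw [hN, densityMeasure, ← withDensity_mul _ hgm.ennreal_ofReal hρm, hM, densityMeasure]
    refine withDensity_congr_ae ?_
    have h2 := h.ae_mem
    rw [densityMeasure, ae_withDensity_iff hfm.ennreal_ofReal] at h2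
    filter_upwards [h2] with x hx
    by_cases h0 : ENNReal.ofReal (mixture p μ f x) = 0
    · have h3 : mixture p μ f x ≤ 0 := ENNReal.ofReal_eq_zero.1 h0
      have h4 : 0 ≤ mixture p μ g x :=
        integral_nonneg fun θ => mul_nonneg (p x θ).coe_nonneg (hg.2.1 θ)
      rw [h0, Pi.mul_apply, hρ]
      simp only
      rw [ENNReal.ofReal_of_nonpos (div_nonpos_of_nonpos_of_nonneg h3 h4), mul_zero]
    · have hpos := h.mixture_pos hp hb hg (hx h0)
      rw [Pi.mul_apply, hρ, ← ENNReal.ofReal_mul hpos.le, mul_div_cancel₀ _ hpos.ne']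
  have hac : M ≪ N := hMN ▸ withDensity_absolutelyContinuous _ _
  have hrn : M.rnDeriv N =ᵐ[M] ρ := by
    refine hac.ae_le ?_
    rw [hMN]
    exact Measure.rnDeriv_withDensity N hρm
  have hllr : llr M N =ᵐ[M] fun x => Real.log (mixture p μ f x / mixture p μ g x) := by
    filter_upwards [hrn, h.ae_mem] with x hx hxG
    rw [llr, hx, hρ, ENNReal.toReal_ofReal
      (div_pos (h.mixture_pos hp hb hf hxG) (h.mixture_pos hp hb hg hxG)).le]
  have hRi : Integrable R M := h.integrable_sq.mono' h.meas_bound.aestronglyMeasurable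
    (ae_of_all _ fun x => by
      have := h.one_le x
      rw [Real.norm_of_nonneg (by linarith)]
      nlinarith)
  have hint : Integrable (llr M N) M := by
    refine Integrable.congr ?_ hllr.symm
    refine hRi.mono' (Real.measurable_log.comp (hfm.div hgm)).aestronglyMeasurable ?_
    filter_upwards [h.ae_mem] with x hx using h.abs_log_le hp hb hf hg hx
  refine ⟨InformationTheory.klDiv_ne_top hac hint, ?_⟩
  rw [klDensity, InformationTheory.toReal_klDiv_of_measure_eq hac (by
    rw [measure_univ, measure_univ])]
  exact integral_congr_ae hllr

theorem logLoss_normalizedKernel (h : RatioBound p ν (mixture p μ f) T G R) [SigmaFinite ν]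
    [SFinite μ] (hp : Measurable (Function.uncurry p)) (hb : ∀ x, BddAbove (p x '' T))
    (h1 : ∀ θ ∈ T, ∫⁻ x, (p x θ : ℝ≥0∞) ∂ν = 1) (hf : IsDensityOn μ T f)
    (hg : IsDensityOn μ T g) (hbd : IsDensityOn (densityMeasure μ g) Set.univ b) :
    logLoss (normalizedKernel p (mixture p μ f) T θs G) (densityMeasure μ g)
        (densityMeasure ν (mixture p μ f)) b
      = (klDensity ν (mixture p μ f) (mixture p μ fun θ => g θ * b θ)).toReal := by
  rw [(h.klDensity_mixture hp hb h1 hf (hg.mul hbd)).2, logLoss, ← integral_neg]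
  refine integral_congr_ae ?_
  filter_upwards [h.ae_mem] with x hx
  rw [h.mixture_normalizedKernel hg b hx, ← Real.log_inv, inv_div]

/-- The factor `m(X_i)` cancels between the kernel and the mixture in each step, so normalising does
not alter the recursion. -/
theorem predictiveRecursion_ae_eq (h : RatioBound p ν m T G R) (hg : IsDensityOn μ T g)
    {w : ℕ → ℝ} {z : ℕ → χ} (hz : ∀ i, 1 ≤ i → z i ∈ G) (n : ℕ) :
    predictiveRecursion p μ w g z n =ᵐ[μ] fun θ => g θ * predictiveRecursion
      (normalizedKernel p m T θs G) (densityMeasure μ g) w (fun _ => 1) z n θ := by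
  induction n with
  | zero => exact ae_of_all _ fun θ => (mul_one _).symm
  | succ n ih =>
    have hx := hz (n + 1) (by omega)
    have hm := h.pos _ hx
    have hmix := h.mixture_normalizedKernel (θs := θs) hg (predictiveRecursion
      (normalizedKernel p m T θs G) (densityMeasure μ g) w (fun _ => 1) z n) hx
    filter_upwards [ih, hg.2.2.1] with θ h1 h2
    rw [predictiveRecursion_succ, predictiveRecursion_succ, recursionStep, recursionStep,
      mixture_congr_ae ih, hmix, h1]
    by_cases hT : θ ∈ T
    · rw [h.normalizedKernel_of_mem hx hT]
      field_simp
    · rw [h2 hT]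
      simp

end RatioBound

/-- The divergence of a mixture from the true density is approximated by the losses of mixtures with
bounded mixing densities relative to a density of full support. -/
theorem RatioBound.exists_logLoss_lt {χ E : Type*} [MeasurableSpace χ] [PseudoMetricSpace E]
    [SecondCountableTopology E] [MeasurableSpace E] [BorelSpace E] {p : χ → E → ℝ≥0}
    {ν : Measure χ} [SigmaFinite ν] {μ : Measure E} [SFinite μ] {K T : Set E} {f f₀ g : E → ℝ}
    {G : Set χ} {R : χ → ℝ} {θs : E} (h : RatioBound p ν (mixture p μ f) T G R)
    (hp : Measurable (Function.uncurry p)) (hb : ∀ x, BddAbove (p x '' T))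
    (hcont : ∀ x, ContinuousOn (p x) T) (h1 : ∀ θ ∈ T, ∫⁻ x, (p x θ : ℝ≥0∞) ∂ν = 1)
    (hT : MeasurableSet T) (hK : IsCompact K) (hKm : MeasurableSet K) (hKT : K ⊆ T)
    (hf : IsDensityOn μ T f) (hθs : θs ∈ T) (hf₀ : IsDensityOn μ K f₀)
    (hsupp : ∀ θ ∈ K, ∀ δ, 0 < δ → 0 < densityMeasure μ f₀ (Metric.ball θ δ))
    (hg : IsDensityOn μ K g) {ε : ℝ} (hε : 0 < ε) :
    ∃ b, IsDensityOn (densityMeasure μ f₀) Set.univ b ∧ (∃ C, ∀ θ, b θ ≤ C) ∧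
      logLoss (normalizedKernel p (mixture p μ f) T θs G) (densityMeasure μ f₀)
        (densityMeasure ν (mixture p μ f)) b
        < (klDensity ν (mixture p μ f) (mixture p μ g)).toReal + ε := by
  have hF := hf₀.isProbabilityMeasure
  have hQ := hg.isProbabilityMeasure
  set F := densityMeasure μ f₀
  set Q := densityMeasure μ g
  set M := densityMeasure ν (mixture p μ f)
  set r := normalizedKernel p (mixture p μ f) T θs G
  have hM : IsProbabilityMeasure M := hf.isProbabilityMeasure_mixture hp hb h1
  have hr : RatioKernel r R := h.ratioKernel hp hb hT hf hθs
  have hRi : Integrable R M := hr.integrable_bound h.integrable_sq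
  set δ : ℕ → ℝ := fun n => 1 / ((n : ℝ) + 1)
  have hδ : ∀ n, 0 < δ n := fun n => Nat.one_div_pos_of_nat
  have hd := fun n => isDensityOn_smoothedDensity hK hKm hsupp hg.ae_mem (hδ n)
  have hlim : ∀ x ∈ G, Tendsto (fun n => mixture r F (smoothedDensity F Q K (δ n)) x) atTop
      (𝓝 (mixture p μ g x / mixture p μ f x)) := by
    intro x hx
    have h2 := h.mixture_normalizedKernel (θs := θs) (hg.mono hKT) (fun _ => 1) hx
    simp only [mul_one] at h2
    rw [← h2]
    simp only [mixture, mul_one]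
    refine tendsto_integral_smoothedDensity hK hKm hsupp hf₀.ae_mem hg.ae_mem
      (hr.measurable_apply x) (c := R x) (fun θ => ?_) ?_ hδ tendsto_one_div_add_atTop_nhds_zero_nat
    · rw [abs_of_pos (hr.pos x θ)]
      exact hr.le x θ
    · have h3 : ContinuousOn (fun θ => (p x θ : ℝ) / mixture p μ f x) K :=
        (NNReal.continuous_coe.comp_continuousOn ((hcont x).mono hKT)).div_const _
      exact h3.congr fun θ hθ => h.normalizedKernel_of_mem hx (hKT hθ)
  have hloss : Tendsto (fun n => logLoss r F M (smoothedDensity F Q K (δ n))) atTop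
      (𝓝 (klDensity ν (mixture p μ f) (mixture p μ g)).toReal) := by
    have h2 : (klDensity ν (mixture p μ f) (mixture p μ g)).toReal
        = -∫ x, Real.log (mixture p μ g x / mixture p μ f x) ∂M := by
      rw [(h.klDensity_mixture hp hb h1 hf (hg.mono hKT)).2, ← integral_neg]
      refine integral_congr_ae (ae_of_all _ fun x => ?_)
      simp only
      rw [← Real.log_inv, inv_div]
    rw [h2]
    -- `R` dominates the logarithm of every mixture of the normalised kernel, whatever the smoothing
    -- radius.
    refine Tendsto.neg (tendsto_integral_of_dominated_convergence R (fun n => ?_) hRi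
      (fun n => ae_of_all _ fun x => hr.abs_log_mixture_le (hd n).1 x) ?_)
    · exact (Real.measurable_log.comp (hr.measurable_mixture (hd n).1.1)).aestronglyMeasurable
    · filter_upwards [h.ae_mem] with x hx
      exact (hlim x hx).log
        (div_pos (h.mixture_pos hp hb (hg.mono hKT) hx) (h.mixture_pos hp hb hf hx)).ne'
  obtain ⟨n, hn⟩ := (hloss.eventually_lt_const (lt_add_of_pos_right _ hε)).exists
  exact ⟨_, (hd n).1, (hd n).2, hn⟩

/-! ### The main theorem -/

theorem mainTheorem5
    {χ : Type*} [TopologicalSpace χ] [MeasurableSpace χ] [BorelSpace χ]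
    (ν : Measure χ) [SigmaFinite ν]
    {d : ℕ} (μ : Measure (EuclideanSpace ℝ (Fin d))) [SigmaFinite μ]
    -- the parameter sets: support of the true and of the initial mixing density, ambient domain
    (Θ Θ₀ Θhat ΘH : Set (EuclideanSpace ℝ (Fin d)))
    (hΘ : IsCompact Θ) (hΘ₀ : IsCompact Θ₀)
    (hhat_closed : IsClosed Θhat) (hhat_convex : Convex ℝ Θhat)
    (hΘhat : Θ ⊆ Θhat) (hΘ₀hat : Θ₀ ⊆ Θhat)
    (hΘH_finite : ΘH.Finite) (hΘHhat : ΘH ⊆ Θhat)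
    (χc : Set χ) (hχc : IsCompact χc)
    -- the kernel
    (p : χ → EuclideanSpace ℝ (Fin d) → ℝ≥0)
    (hp_meas : Measurable (Function.uncurry p))
    (hp_density : ∀ θ ∈ Θhat, ∫⁻ x, (p x θ : ℝ≥0∞) ∂ν = 1)
    -- the true mixing density and the initial estimate
    (f f₀ : EuclideanSpace ℝ (Fin d) → ℝ)
    (hf : IsDensityOn μ Θ f)
    (hf₀ : IsDensityOn μ Θ₀ f₀)
    (hf₀_support : (μ.withDensity (fun θ => ENNReal.ofReal (f₀ θ))).support = Θ₀)
    -- the observations `X 1, X 2, …`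
    {Ω : Type*} [MeasurableSpace Ω] (P : Measure Ω) [IsProbabilityMeasure P]
    (X : ℕ → Ω → χ) (hX_meas : ∀ i, 1 ≤ i → Measurable (X i))
    (hX_law : ∀ i, 1 ≤ i → P.map (X i) = densityMeasure ν (mixture p μ f))
    (q : ℕ) (hq : 1 ≤ q) (hX_dep : IsMDependent (q - 1) X P)
    -- the weights `w 1, w 2, …`
    (w : ℕ → ℝ) (hw : ∀ i, 1 ≤ i → 0 < w i ∧ w i ≤ 1)
    (hA1 : CondA1 q w)
    (hA2 : CondA2 p ν μ Θ)
    (hA3 : CondA3 p (Θ ∪ Θ₀))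
    (hA4 : CondA4 p ν q (Θ ∪ Θ₀ ∪ ΘH) Θ)
    (hC1 : CondC1 p (Θ ∪ Θ₀) ΘH χc)
    (hC2 : CondC2 p (Θ ∪ Θ₀) χc)
    (hC3 : CondC3 p (Θ ∪ Θ₀) χc) :
    infKL p ν μ Θ₀ (mixture p μ f) ≠ ∞ ∧
    ∀ᵐ ω ∂P,
      (∀ n, klDensity ν (mixture p μ f)
        (mixture p μ (predictiveRecursion p μ w f₀ (fun i => X i ω) n)) ≠ ∞) ∧
      Tendsto (fun n =>
          (klDensity ν (mixture p μ f)
            (mixture p μ (predictiveRecursion p μ w f₀ (fun i => X i ω) n))).toReal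
          - (infKL p ν μ Θ₀ (mixture p μ f)).toReal)
        atTop (𝓝 0) := by
  set T := Θ ∪ Θ₀ with hT_def
  set m := mixture p μ f with hm_def
  set M := densityMeasure ν m with hM_def
  obtain ⟨-, hw0, hw1, hw2⟩ := hA1
  have hT : MeasurableSet T := (hΘ.union hΘ₀).measurableSet
  have hb : ∀ x, BddAbove (p x '' T) := fun x => (hA3 x).1
  have hdens : ∀ θ ∈ T, ∫⁻ x, (p x θ : ℝ≥0∞) ∂ν = 1 := fun θ hθ =>
    hp_density θ (Set.union_subset hΘhat hΘ₀hat hθ)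
  have hfT : IsDensityOn μ T f := hf.mono Set.subset_union_left
  have hf₀T : IsDensityOn μ T f₀ := hf₀.mono Set.subset_union_right
  have hM : IsProbabilityMeasure M := hfT.isProbabilityMeasure_mixture hp_meas hb hdens
  obtain ⟨G, R, hRB⟩ := exists_ratioBound hq hp_meas hf Set.subset_union_left
    (fun x => (hb x).mono (Set.image_mono Set.subset_union_left)) hΘH_finite hM hA4 hC1 hC2 hC3
  obtain ⟨θs, hθs⟩ := hfT.nonempty
  set F := densityMeasure μ f₀ with hF_def
  have hF : IsProbabilityMeasure F := hf₀.isProbabilityMeasure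
  set r := normalizedKernel p m T θs G with hr_def
  have hr : RatioKernel r R := hRB.ratioKernel hp_meas hb hT hfT hθs
  have hsupp : ∀ θ ∈ Θ₀, ∀ δ, 0 < δ → 0 < F (Metric.ball θ δ) := by
    intro θ hθ
    rw [← hf₀_support] at hθ
    exact Metric.nhds_basis_ball.mem_measureSupport.1 hθ
  -- Already the weights along the class `j = 1` have an infinite sum.
  have hw1' : ¬ Summable w := fun hs => hw1 1 ⟨le_rfl, hq⟩
    (hs.comp_injective fun i j hij => by
      have : i * q = j * q := by simpa using hij
      exact Nat.eq_of_mul_eq_mul_right hq this)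
  have hloss : ∀ b, IsDensityOn F Set.univ b →
      logLoss r F M b = (klDensity ν m (mixture p μ fun θ => f₀ θ * b θ)).toReal := fun b hbd =>
    hRB.logLoss_normalizedKernel hp_meas hb hdens hfT hf₀T hbd
  set κ := infKL p ν μ Θ₀ m with hκ_def
  have hκ_le : ∀ g, IsDensityOn μ Θ₀ g → κ ≤ klDensity ν m (mixture p μ g) := fun g hg =>
    iInf₂_le g hg
  have hfin : ∀ g, IsDensityOn μ Θ₀ g → klDensity ν m (mixture p μ g) ≠ ∞ := fun g hg =>
    (hRB.klDensity_mixture hp_meas hb hdens hfT (hg.mono Set.subset_union_right)).1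
  have hκ : κ ≠ ∞ := ne_top_of_le_ne_top (hfin f₀ hf₀) (hκ_le f₀ hf₀)
  refine ⟨hκ, ?_⟩
  -- Half of `1 / (j + 1)` is spent on coming close to the infimum, half on smoothing. A sequence of
  -- comparison densities is needed, as the exceptional null set depends on the density.
  have happrox : ∀ j : ℕ, ∃ b, IsDensityOn F Set.univ b ∧ (∃ C, ∀ θ, b θ ≤ C) ∧
      logLoss r F M b < κ.toReal + 1 / ((j : ℝ) + 1) := by
    intro j
    have hε : 0 < 1 / ((j : ℝ) + 1) / 2 := half_pos Nat.one_div_pos_of_nat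
    have hlt : κ < κ + ENNReal.ofReal (1 / ((j : ℝ) + 1) / 2) :=
      ENNReal.lt_add_right hκ (ENNReal.ofReal_pos.2 hε).ne'
    obtain ⟨g, hg, hgκ⟩ : ∃ g, ∃ _ : IsDensityOn μ Θ₀ g,
        klDensity ν m (mixture p μ g) < κ + ENNReal.ofReal (1 / ((j : ℝ) + 1) / 2) := by
      have h2 : (⨅ (g) (_ : IsDensityOn μ Θ₀ g), klDensity ν m (mixture p μ g))
          < κ + ENNReal.ofReal (1 / ((j : ℝ) + 1) / 2) := hlt
      simpa only [iInf_lt_iff] using h2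
    obtain ⟨b, hbd, hC, hlt'⟩ := hRB.exists_logLoss_lt (θs := θs) hp_meas hb (fun x => (hA3 x).2)
      hdens hT hΘ₀ hΘ₀.measurableSet Set.subset_union_right hfT hθs hf₀ hsupp hg hε
    refine ⟨b, hbd, hC, hlt'.trans_le ?_⟩
    have h2 := ENNReal.toReal_mono (ENNReal.add_ne_top.2 ⟨hκ, ENNReal.ofReal_ne_top⟩) hgκ.le
    rw [ENNReal.toReal_add hκ ENNReal.ofReal_ne_top, ENNReal.toReal_ofReal hε.le] at h2
    linarith
  choose b hbd hbC hbκ using happrox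
  choose C hbC using hbC
  have hlim := hr.ae_tendsto_logLoss (F := F) hRB.integrable_sq hq hX_meas hX_law hX_dep hw hw0 hw2
  have hle : ∀ᵐ ω ∂P, ∀ j, ∀ l, Tendsto (fun n => logLoss r F M
      (predictiveRecursion r F w (fun _ => 1) (fun i => X i ω) n)) atTop (𝓝 l) →
      l ≤ logLoss r F M (b j) := ae_all_iff.2 fun j =>
    hr.ae_limit_logLoss_le hRB.integrable_sq hq hX_meas hX_law hX_dep hw hw0 hw1' hw2 (hbd j)
      (hbC j)
  have hmem : ∀ᵐ ω ∂P, ∀ i, 1 ≤ i → X i ω ∈ G := by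
    refine ae_all_iff.2 fun i => ?_
    by_cases hi : 1 ≤ i
    · have h2 : ∀ᵐ x ∂(P.map (X i)), x ∈ G := hX_law i hi ▸ hRB.ae_mem
      filter_upwards [ae_of_ae_map (hX_meas i hi).aemeasurable h2] with ω hω _ using hω
    · exact ae_of_all _ fun ω h => (hi h).elim
  filter_upwards [hlim, hle, hmem] with ω ⟨l, hl⟩ hle hmem
  have hd : ∀ n, IsDensityOn F Set.univ
      (predictiveRecursion r F w (fun _ => 1) (fun i => X i ω) n) :=
    hr.isDensityOn_predictiveRecursion hw _
  have hmix : ∀ n, mixture p μ (predictiveRecursion p μ w f₀ (fun i => X i ω) n)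
      = mixture p μ fun θ => f₀ θ * predictiveRecursion r F w (fun _ => 1) (fun i => X i ω) n θ :=
    fun n => mixture_congr_ae (hRB.predictiveRecursion_ae_eq hf₀T hmem n)
  simp_rw [hmix, ← fun n => hloss _ (hd n)]
  refine ⟨fun n => hfin _ (hf₀.mul (hd n)), ?_⟩
  -- Each estimate is a density on `Θ₀`, so it competes in the infimum.
  have hκl : κ.toReal ≤ l := by
    refine ge_of_tendsto' hl fun n => ?_
    rw [hloss _ (hd n)]
    exact ENNReal.toReal_mono (hfin _ (hf₀.mul (hd n))) (hκ_le _ (hf₀.mul (hd n)))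
  have hlκ : l ≤ κ.toReal := by
    have h2 : Tendsto (fun j : ℕ => κ.toReal + 1 / ((j : ℝ) + 1)) atTop (𝓝 (κ.toReal + 0)) :=
      tendsto_const_nhds.add tendsto_one_div_add_atTop_nhds_zero_nat
    rw [add_zero] at h2
    exact ge_of_tendsto' h2 fun j => (hle j l hl).trans (hbκ j).le
  rw [le_antisymm hlκ hκl] at hl
  simpa using hl.sub_const κ.toReal
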